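/- **Notation.** For $\operatorname{Im}\tau>0$ and integers $\alpha,\beta$ let $$\theta_{\alpha\beta}(z|\tau)=\sum_{k\in\mathbb Z}e^{\pi i(k+\frac\alpha2)^2\tau+2\pi i(k+\frac\alpha2)(z+\frac\beta2)},$$ $\theta_1(z|\tau)=-\theta_{11}(z|\tau)$, $\theta_2(z|\tau)=\theta_{10}(z|\tau)$, $\theta_3(z|\tau)=\theta_{00}(z|\tau)$, $\theta_4(z|\tau)=\theta_{01}(z|\tau)$, $\theta_1'(z|\tau)=\partial_z\theta_1(z|\tau)$, $\vartheta_k(\tau)=\theta_k(0|\tau)$, $$\eta(\tau)=2\pi^2\Big\{\tfrac1{24}-\sum_{k\ge1}\frac{e^{2k\pi i\tau}}{(1-e^{2k\pi i\tau})^2}\Big\},\qquad \boldsymbol\eta(\tau)=e^{\frac{\pi i}{12}\tau}\prod_{k\ge1}(1-e^{2k\pi i\tau}).$$ Symbols carrying an argument $\tau$ always mean these canonical series; $\vartheta_2,\vartheta_3,\vartheta_4,\eta$ without argument are arbitrary complex parameters with $\vartheta_2\vartheta_3\vartheta_4\ne0$. Put $\Lambda=4\{\eta+\frac{\pi^2}{12}(\vartheta_3^4+\vartheta_4^4)\}$.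 The $z$-system for unknown functions $\theta_1,\theta_2,\theta_3,\theta_4,\theta_1'$ of a complex variable $z$ (with $\theta_1$ free of zeros on the domain considered) is $$\frac{d\theta_1}{dz}=\theta_1',\qquad \frac{d\theta_k}{dz}=\frac{\theta_1'}{\theta_1}\theta_k-\pi\vartheta_k^2\frac{\theta_\nu\theta_\mu}{\theta_1}\quad(\{k,\nu,\mu\}=\{2,3,4\}),$$ $$\frac{d\theta_1'}{dz}=\frac{\theta_1'^2}{\theta_1}-\pi^2\vartheta_3^2\vartheta_4^2\frac{\theta_2^2}{\theta_1}-\Lambda\,\theta_1. \tag{34}$$ Its form with characteristics is, for all integers $\alpha,\beta$, $$\frac{d\theta_{\alpha\beta}}{dz}=\frac{\theta_1'}{\theta_1}\theta_{\alpha\beta}-(-1)^{[\beta/2]\alpha}\pi\vartheta_{\alpha\beta}^2\frac{\theta_{\alpha-1,0}\,\theta_{0,\beta-1}}{\theta_1}, \tag{52}$$ together with the last equation of (34), where $\theta_{11}=-\theta_1$, $\theta_{10}=\theta_2$, $\theta_{00}=\theta_3$, $\theta_{01}=\theta_4$, $\theta_{\alpha+2m,\beta+2n}=(-1)^{\alpha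 n}\theta_{\alpha\beta}$, and likewise for $\vartheta_{\alpha\beta}$ with $\vartheta_1=0$. A solution is called nondegenerate if none of $\vartheta_2^2\theta_4^2-\vartheta_4^2\theta_2^2$, $\vartheta_2^2\theta_3^2-\vartheta_3^2\theta_2^2$, $\vartheta_3^2\theta_4^2-\vartheta_4^2\theta_3^2$ vanishes at some point of its domain; initial values at a point are called nondegenerate if none of these three quantities vanishes. **Theorem 9.1.** Systems (34) and (52) have the same solutions. For complex constants $A,B,C,\varkappa$ and $\tau$ with $\operatorname{Im}\tau>0$ put $$M=\varkappa^2\Big\{\eta(\tau)+\tfrac{\pi^2}{12}[\vartheta_3^4(\tau)+\vartheta_4^4(\tau)]\Big\}-\Big\{\eta+\tfrac{\pi^2}{12}[\vartheta_3^4+\vartheta_4^4]\Big\}$$ and consider the functions $$\pm\theta_1=\frac{\vartheta_2\vartheta_3\vartheta_4}{2\boldsymbol\eta^3(\tau)}\,C\,\theta_1(\varkappa z+B|\tau)\,e^{2M(z+A)^2},\qquad \pm\theta_k=\frac{\varkappa\vartheta_k}{\vartheta_k(\tau)}\,C\,\theta_k(\varkappa z+B|\tau)\,e^{2M(z+A)^2}\quad(k=2,3,4),$$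 $$\pm\theta_1'=\frac{\vartheta_2\vartheta_3\vartheta_4}{2\boldsymbol\eta^3(\tau)}\,C\,\{\varkappa\,\theta_1'(\varkappa z+B|\tau)+4M(z+A)\,\theta_1(\varkappa z+B|\tau)\}\,e^{2M(z+A)^2}, \tag{83}$$ where the signs of $\theta_1,\dots,\theta_4$ are fixed in any way with an even number of minus signs, and $\theta_1'$ has the sign of $\theta_1$. Then, for each such choice of signs: 1. for all $A,B,\varkappa\in\mathbb C$, $C\ne0$, $\operatorname{Im}\tau>0$, the functions (83) solve the system on $\{z:\theta_1(\varkappa z+B|\tau)\neq0\}$, and if $\varkappa\ne0$ none of the three quantities above vanishes at any point of this set; 2. $\{A,B,C,\varkappa,\tau\}$ is a complete set of integration constants: for every $z_0\in\mathbb C$ and all nondegenerate initial values $(\theta_1,\theta_2,\theta_3,\theta_4,\theta_1')\in\mathbb C^5$ at $z_0$ with $\theta_1\ne0$ there are constants $A,B,C,\varkappa,\tau$ with $C\varkappa\neq0$, $\operatorname{Im}\tau>0$ for which the functions (83) take these values at $z_0$; 3. every nondegenerate solution on a connected open set $U\subset\mathbb C$ is given on $U$ by (83) for some $A,B,C,\varkappa,\tau$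 with $C\varkappa\ne0$, $\operatorname{Im}\tau>0$. -/

import Mathlib

open Complex

noncomputable section

namespace ThetaODE

/-! ### The canonical series -/

/-- The theta series with integer characteristics,
`θ_{αβ}(z|τ) = ∑_k exp(πi (k + α/2)² τ + 2πi (k + α/2)(z + β/2))`, for `Im τ > 0`. -/
def thetaChar (α β : ℤ) (z τ : ℂ) : ℂ :=
  ∑' k : ℤ, cexp (Real.pi * I * (k + α / 2) ^ 2 * τ
    + 2 * Real.pi * I * (k + α / 2) * (z + β / 2))

/-- Jacobi's `θ₁(z|τ) = -θ_{11}(z|τ)`. -/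
def theta1 (z τ : ℂ) : ℂ := -thetaChar 1 1 z τ

/-- Jacobi's `θ₂(z|τ) = θ_{10}(z|τ)`. -/
def theta2 (z τ : ℂ) : ℂ := thetaChar 1 0 z τ

/-- Jacobi's `θ₃(z|τ) = θ_{00}(z|τ)`. -/
def theta3 (z τ : ℂ) : ℂ := thetaChar 0 0 z τ

/-- Jacobi's `θ₄(z|τ) = θ_{01}(z|τ)`. -/
def theta4 (z τ : ℂ) : ℂ := thetaChar 0 1 z τ

/-- The fifth function `θ₁'(z|τ) = ∂θ₁(z|τ)/∂z`. -/
def dtheta1 (z τ : ℂ) : ℂ := deriv (fun w : ℂ => theta1 w τ) z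

/-- The Weierstrass function
`η(τ) = 2π² (1/24 - ∑_{k ≥ 1} exp(2πikτ) / (1 - exp(2πikτ))²)`. -/
def etaW (τ : ℂ) : ℂ :=
  2 * Real.pi ^ 2 * (1 / 24 - ∑' k : ℕ, cexp (2 * (k + 1) * Real.pi * I * τ)
    / (1 - cexp (2 * (k + 1) * Real.pi * I * τ)) ^ 2)

/-! ### The systems of differential equations -/

/-- The parameters `ϑ₂, ϑ₃, ϑ₄, η` of the equations: complex numbers which are not required to be
values of theta-constants or of the Weierstrass function. -/
structure Params where
  v2 : ℂ
  v3 : ℂ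
  v4 : ℂ
  eta : ℂ

/-- The combination `η + (π²/12) (ϑ₃⁴ + ϑ₄⁴)` of the parameters. -/
def Params.lam (P : Params) : ℂ := P.eta + Real.pi ^ 2 / 12 * (P.v3 ^ 4 + P.v4 ^ 4)

/-- The five values `(θ₁, θ₂, θ₃, θ₄, θ₁')` of the unknown functions at one point. -/
@[ext] structure Values where
  t1 : ℂ
  t2 : ℂ
  t3 : ℂ
  t4 : ℂ
  d1 : ℂ

/-- The `z`-system for the unknown functions `(θ₁, θ₂, θ₃, θ₄, θ₁')` on a set `U`. The equations
divide by `θ₁`, so `θ₁` has no zero in `U`. -/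
structure IsSolution (P : Params) (U : Set ℂ) (X : ℂ → Values) : Prop where
  ne_zero : ∀ z ∈ U, (X z).t1 ≠ 0
  eq1 : ∀ z ∈ U, HasDerivAt (fun w => (X w).t1) (X z).d1 z
  eq2 : ∀ z ∈ U, HasDerivAt (fun w => (X w).t2)
    ((X z).d1 / (X z).t1 * (X z).t2
      - Real.pi * P.v2 ^ 2 * ((X z).t3 * (X z).t4 / (X z).t1)) z
  eq3 : ∀ z ∈ U, HasDerivAt (fun w => (X w).t3)
    ((X z).d1 / (X z).t1 * (X z).t3
      - Real.pi * P.v3 ^ 2 * ((X z).t2 * (X z).t4 / (X z).t1)) z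
  eq4 : ∀ z ∈ U, HasDerivAt (fun w => (X w).t4)
    ((X z).d1 / (X z).t1 * (X z).t4
      - Real.pi * P.v4 ^ 2 * ((X z).t2 * (X z).t3 / (X z).t1)) z
  eq5 : ∀ z ∈ U, HasDerivAt (fun w => (X w).d1)
    ((X z).d1 ^ 2 / (X z).t1
      - Real.pi ^ 2 * P.v3 ^ 2 * P.v4 ^ 2 * ((X z).t2 ^ 2 / (X z).t1)
      - 4 * P.lam * (X z).t1) z

/-- The family with integer characteristics generated by four quantities: `θ_{11} = -θ₁`,
`θ_{10} = θ₂`, `θ_{00} = θ₃`, `θ_{01} = θ₄`, extended to all integers by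
`θ_{α+2m, β+2n} = (-1)^{αn} θ_{αβ}`. -/
def charFamily (t1 t2 t3 t4 : ℂ) (α β : ℤ) : ℂ :=
  (-1) ^ (α * (β / 2)) *
    (if Odd α then (if Odd β then -t1 else t2) else (if Odd β then t4 else t3))

/-- The unknown functions in terms of characteristics. -/
def Values.char (V : Values) (α β : ℤ) : ℂ := charFamily V.t1 V.t2 V.t3 V.t4 α β

/-- The parameters `ϑ` in terms of characteristics; `ϑ₁ = 0`. -/
def Params.char (P : Params) (α β : ℤ) : ℂ := charFamily 0 P.v2 P.v3 P.v4 α β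

/-- The `z`-system written for the functions `θ_{αβ}` with arbitrary integer characteristics
and for `θ₁'`. -/
structure IsCharSolution (P : Params) (U : Set ℂ) (X : ℂ → Values) : Prop where
  ne_zero : ∀ z ∈ U, (X z).t1 ≠ 0
  eqChar : ∀ α β : ℤ, ∀ z ∈ U, HasDerivAt (fun w => (X w).char α β)
    ((X z).d1 / (X z).t1 * (X z).char α β
      - (-1) ^ (β / 2 * α) * Real.pi * P.char α β ^ 2
        * ((X z).char (α - 1) 0 * (X z).char 0 (β - 1) / (X z).t1)) z
  eqD : ∀ z ∈ U, HasDerivAt (fun w => (X w).d1)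
    ((X z).d1 ^ 2 / (X z).t1
      - Real.pi ^ 2 * P.v3 ^ 2 * P.v4 ^ 2 * ((X z).t2 ^ 2 / (X z).t1)
      - 4 * P.lam * (X z).t1) z

/-- Values at which none of the quadratic integrals of the system
`(ϑ_j² θ_k² - ϑ_k² θ_j²) / θ₁²`, `j, k ∈ {2, 3, 4}`, `j ≠ k`, vanishes. (Otherwise the solution
degenerates into elementary functions.) -/
structure Nondegenerate (P : Params) (V : Values) : Prop where
  h24 : P.v2 ^ 2 * V.t4 ^ 2 - P.v4 ^ 2 * V.t2 ^ 2 ≠ 0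
  h23 : P.v2 ^ 2 * V.t3 ^ 2 - P.v3 ^ 2 * V.t2 ^ 2 ≠ 0
  h34 : P.v3 ^ 2 * V.t4 ^ 2 - P.v4 ^ 2 * V.t3 ^ 2 ≠ 0

/-! ### The exponential-quadratic extension of the canonical series -/

/-- `M = ϰ² (η(τ) + (π²/12) (ϑ₃(τ)⁴ + ϑ₄(τ)⁴)) - (η + (π²/12) (ϑ₃⁴ + ϑ₄⁴))`. -/
def coeffM (P : Params) (κ τ : ℂ) : ℂ :=
  κ ^ 2 * (etaW τ + Real.pi ^ 2 / 12 * (theta3 0 τ ^ 4 + theta4 0 τ ^ 4)) - P.lam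

/-- The explicit five-parameter family, with signs `s₁, s₂, s₃, s₄`. Here `ModularForm.eta` is
the Dedekind function, and the sign of `θ₁'` is the one of `θ₁`. -/
def extension (P : Params) (s1 s2 s3 s4 : ℤˣ) (A B C κ τ : ℂ) (z : ℂ) : Values where
  t1 := ((s1 : ℤ) : ℂ) * (P.v2 * P.v3 * P.v4 / (2 * ModularForm.eta τ ^ 3)
    * (C * theta1 (κ * z + B) τ * cexp (2 * coeffM P κ τ * (z + A) ^ 2)))
  t2 := ((s2 : ℤ) : ℂ) * (κ * P.v2 / theta2 0 τ
    * (C * theta2 (κ * z + B) τ * cexp (2 * coeffM P κ τ * (z + A) ^ 2)))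
  t3 := ((s3 : ℤ) : ℂ) * (κ * P.v3 / theta3 0 τ
    * (C * theta3 (κ * z + B) τ * cexp (2 * coeffM P κ τ * (z + A) ^ 2)))
  t4 := ((s4 : ℤ) : ℂ) * (κ * P.v4 / theta4 0 τ
    * (C * theta4 (κ * z + B) τ * cexp (2 * coeffM P κ τ * (z + A) ^ 2)))
  d1 := ((s1 : ℤ) : ℂ) * (P.v2 * P.v3 * P.v4 / (2 * ModularForm.eta τ ^ 3)
    * (C * (κ * dtheta1 (κ * z + B) τ
        + 4 * coeffM P κ τ * (z + A) * theta1 (κ * z + B) τ)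
      * cexp (2 * coeffM P κ τ * (z + A) ^ 2)))

end ThetaODE

end

noncomputable section

namespace ThetaODE

open Filter Topology

/-! ### The four theta functions and their shifts -/

/-! The canonical theta functions satisfy the system with their own theta constants as parameters.
An affine change of argument, constant factors and a common Gaussian `exp (2M(z + A)²)` carry it to
arbitrary parameters: the Gaussian adds the same term to every logarithmic derivative, so the
first-order equations do not notice it, while `(log θ₁)''` is shifted by `4M`, which turns `κ²`
times the canonical constant into `P.lam`.

The canonical identities come from the product formula `theta3_mul_theta3`, which passes from `τ` to
`2τ`. On the diagonal it gives the quadratic relations; differentiated across the diagonal it gives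
`wronskian21` and `second_order_double`. Constants are found by iterating `τ ↦ 2τ` towards `i∞`
(`theta_ne_zero`, `dtheta1_zero`). The Weierstrass `η` enters `second_order` through the heat
equation and `ϑ₂ϑ₃ϑ₄ = 2η³` (Dedekind's function on the right), proved in `thetaProd_eq_eta` by the
constancy of level-one forms of weight zero.

For completeness, the differences of `θ_k² / (ϑ_k² θ₁²)` are first integrals. They prescribe
`κ²ϑ₃(τ)⁴` and `κ²ϑ₄(τ)⁴`; surjectivity of `λ` onto `ℂ ∖ {0, 1}` (`modLambda_surjective`) supplies
`τ`, and then `κ²` is determined. A theta function of order two has a zero, which supplies the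
argument `u = κz₀ + B`; half-period shifts and the sign of `κ` repair the signs. Next `A` is read
off from `θ₁'`, provided `M ≠ 0`, and `C` from the size of `θ₁`. If `M = 0`, an equivalent `τ` is
used: it keeps the ratios of the `ϑ_k⁴`, but `η(τ)` is only quasi-modular, so `M` changes
(`exists_congruent_modulus`). Local uniqueness for the differential equation and the identity
theorem then cover all nondegenerate solutions. -/

lemma theta3_eq (z τ : ℂ) : theta3 z τ = jacobiTheta₂ z τ := by
  unfold theta3 thetaChar jacobiTheta₂ jacobiTheta₂_term
  refine tsum_congr fun k => ?_
  congr 1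
  push_cast
  ring

lemma theta4_eq (z τ : ℂ) : theta4 z τ = theta3 (z + 1 / 2) τ := by
  unfold theta3 theta4 thetaChar
  refine tsum_congr fun k => ?_
  congr 1
  push_cast
  ring

lemma theta2_eq (z τ : ℂ) :
    theta2 z τ = cexp (Real.pi * I * τ / 4 + Real.pi * I * z) * theta3 (z + τ / 2) τ := by
  unfold theta3 theta2 thetaChar
  rw [← tsum_mul_left]
  refine tsum_congr fun k => ?_
  rw [← Complex.exp_add]
  congr 1
  push_cast
  ring

lemma theta1_eq (z τ : ℂ) : theta1 z τ = -theta2 (z + 1 / 2) τ := by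
  unfold theta1 theta2 thetaChar
  congr 1
  refine tsum_congr fun k => ?_
  congr 1
  push_cast
  ring

lemma theta3_add_one (z τ : ℂ) : theta3 (z + 1) τ = theta3 z τ := by
  simp only [theta3_eq, jacobiTheta₂_add_left]

lemma theta3_add_tau (z τ : ℂ) :
    theta3 (z + τ) τ = cexp (-Real.pi * I * (τ + 2 * z)) * theta3 z τ := by
  simp only [theta3_eq, jacobiTheta₂_add_left']

lemma theta3_neg (z τ : ℂ) : theta3 (-z) τ = theta3 z τ := by
  simp only [theta3_eq, jacobiTheta₂_neg_left]

lemma exp_pi_I_mul_add_one (z : ℂ) :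
    cexp (Real.pi * I * (z + 1)) = -cexp (Real.pi * I * z) := by
  rw [mul_add, Complex.exp_add, mul_one, Complex.exp_pi_mul_I]; ring

lemma theta2_add_one (z τ : ℂ) : theta2 (z + 1) τ = -theta2 z τ := by
  rw [theta2_eq, theta2_eq, show z + 1 + τ / 2 = z + τ / 2 + 1 by ring, theta3_add_one,
    Complex.exp_add, exp_pi_I_mul_add_one, Complex.exp_add]
  ring

lemma theta2_add_tau (z τ : ℂ) :
    theta2 (z + τ) τ = cexp (-Real.pi * I * (τ + 2 * z)) * theta2 z τ := by
  rw [theta2_eq, theta2_eq, show z + τ + τ / 2 = z + τ / 2 + τ by ring, theta3_add_tau,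
    ← mul_assoc, ← mul_assoc, ← Complex.exp_add, ← Complex.exp_add]
  congr 2
  ring

lemma theta2_neg (z τ : ℂ) : theta2 (-z) τ = theta2 z τ := by
  rw [theta2_eq, theta2_eq, ← theta3_neg, show -(-z + τ / 2) = z - τ / 2 by ring,
    show z + τ / 2 = (z - τ / 2) + τ by ring, theta3_add_tau, ← mul_assoc, ← Complex.exp_add]
  congr 2
  ring

lemma theta4_add_one (z τ : ℂ) : theta4 (z + 1) τ = theta4 z τ := by
  rw [theta4_eq, theta4_eq, show z + 1 + 1 / 2 = z + 1 / 2 + 1 by ring, theta3_add_one]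

lemma theta1_add_one (z τ : ℂ) : theta1 (z + 1) τ = -theta1 z τ := by
  rw [theta1_eq, theta1_eq, show z + 1 + 1 / 2 = z + 1 / 2 + 1 by ring, theta2_add_one]

lemma exp_tau_shift_half (z τ : ℂ) : cexp (-Real.pi * I * (τ + 2 * (z + 1 / 2)))
    = -cexp (-Real.pi * I * (τ + 2 * z)) := by
  rw [show -Real.pi * I * (τ + 2 * (z + 1 / 2))
    = -Real.pi * I * (τ + 2 * z) + -(Real.pi * I) by ring, Complex.exp_add, Complex.exp_neg,
    Complex.exp_pi_mul_I]
  norm_num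

lemma theta4_add_tau (z τ : ℂ) :
    theta4 (z + τ) τ = -(cexp (-Real.pi * I * (τ + 2 * z)) * theta4 z τ) := by
  rw [theta4_eq, theta4_eq, show z + τ + 1 / 2 = z + 1 / 2 + τ by ring, theta3_add_tau,
    exp_tau_shift_half]
  ring

lemma theta1_add_tau (z τ : ℂ) :
    theta1 (z + τ) τ = -(cexp (-Real.pi * I * (τ + 2 * z)) * theta1 z τ) := by
  rw [theta1_eq, theta1_eq, show z + τ + 1 / 2 = z + 1 / 2 + τ by ring, theta2_add_tau,
    exp_tau_shift_half]
  ring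

lemma theta4_neg (z τ : ℂ) : theta4 (-z) τ = theta4 z τ := by
  rw [theta4_eq, theta4_eq, ← theta3_neg, ← theta3_add_one]
  congr 1; ring

lemma theta1_neg (z τ : ℂ) : theta1 (-z) τ = -theta1 z τ := by
  rw [theta1_eq, theta1_eq, ← theta2_neg, ← neg_neg (theta2 (-(-z + 1 / 2)) τ), ← theta2_add_one]
  congr 3; ring

lemma theta1_zero (τ : ℂ) : theta1 0 τ = 0 := by
  have h := theta1_neg 0 τ
  rw [neg_zero] at h
  exact self_eq_neg.mp h

/-! ### Product formulas -/

lemma summable_jacobiTheta₂_mul (x y : ℂ) {τ : ℂ} (hτ : 0 < τ.im) :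
    Summable (fun p : ℤ × ℤ => jacobiTheta₂_term p.1 x τ * jacobiTheta₂_term p.2 y τ) :=
  summable_mul_of_summable_norm (f := fun n => jacobiTheta₂_term n x τ)
    (g := fun n => jacobiTheta₂_term n y τ)
    ((summable_jacobiTheta₂_term_iff x τ).2 hτ).norm ((summable_jacobiTheta₂_term_iff y τ).2 hτ).norm

lemma hasSum_jacobiTheta₂_mul (x y : ℂ) {τ : ℂ} (hτ : 0 < τ.im) :
    HasSum (fun p : ℤ × ℤ => jacobiTheta₂_term p.1 x τ * jacobiTheta₂_term p.2 y τ)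
      (theta3 x τ * theta3 y τ) := by
  have hx := hasSum_jacobiTheta₂_term x hτ
  have hy := hasSum_jacobiTheta₂_term y hτ
  rw [← theta3_eq] at hx hy
  obtain ⟨u, hu⟩ := summable_jacobiTheta₂_mul x y hτ
  have h := HasSum.mul_eq hx hy hu
  rwa [h]

/-- Pairs of integers according to the parity of their sum. -/
def sumDiffEquiv : (ℤ × ℤ) ⊕ (ℤ × ℤ) ≃ ℤ × ℤ where
  toFun := Sum.elim (fun p => (p.1 + p.2, p.1 - p.2)) (fun p => (p.1 + p.2 + 1, p.1 - p.2))
  invFun p := if (p.1 + p.2) % 2 = 0 then Sum.inl ((p.1 + p.2) / 2, (p.1 - p.2) / 2)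
    else Sum.inr ((p.1 + p.2 - 1) / 2, (p.1 - p.2 - 1) / 2)
  left_inv := by
    rintro (⟨a, b⟩ | ⟨a, b⟩)
    · have h : (a + b + (a - b)) % 2 = 0 := by omega
      simp only [Sum.elim_inl, h, if_true]
      congr 2 <;> omega
    · have h : ¬ (a + b + 1 + (a - b)) % 2 = 0 := by omega
      simp only [Sum.elim_inr, h, if_false]
      congr 2 <;> omega
  right_inv := by
    rintro ⟨m, n⟩
    by_cases h : (m + n) % 2 = 0
    · simp only [h, if_true, Sum.elim_inl, Prod.mk.injEq]
      omega
    · simp only [h, if_false, Sum.elim_inr, Prod.mk.injEq]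
      omega

lemma two_mul_im_pos {τ : ℂ} (hτ : 0 < τ.im) : 0 < (2 * τ).im := by simpa using hτ

/-- The double sum over `(m, n)` is split by the parity of `m + n`. With `m = a + b`, `n = a - b`
one has `m² + n² = 2(a² + b²)`, whence the modulus `2τ`; in the odd class `a` and `b` become
half-integers, which gives `θ₂`. The other product formulas follow by half-period shifts. -/
lemma theta3_mul_theta3 (x y : ℂ) {τ : ℂ} (hτ : 0 < τ.im) :
    theta3 x τ * theta3 y τ = theta3 (x + y) (2 * τ) * theta3 (x - y) (2 * τ)
      + theta2 (x + y) (2 * τ) * theta2 (x - y) (2 * τ) := by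
  have h2 := two_mul_im_pos hτ
  have h := (sumDiffEquiv.hasSum_iff).2 (hasSum_jacobiTheta₂_mul x y hτ)
  have hl : HasSum (fun p : ℤ × ℤ => jacobiTheta₂_term (p.1 + p.2) x τ
      * jacobiTheta₂_term (p.1 - p.2) y τ)
      (theta3 (x + y) (2 * τ) * theta3 (x - y) (2 * τ)) := by
    refine (hasSum_jacobiTheta₂_mul (x + y) (x - y) h2).congr_fun fun p => ?_
    simp only [jacobiTheta₂_term, ← Complex.exp_add]
    congr 1
    push_cast
    ring
  have hr : HasSum (fun p : ℤ × ℤ => jacobiTheta₂_term (p.1 + p.2 + 1) x τ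
      * jacobiTheta₂_term (p.1 - p.2) y τ)
      (theta2 (x + y) (2 * τ) * theta2 (x - y) (2 * τ)) := by
    rw [theta2_eq, theta2_eq, mul_mul_mul_comm]
    refine ((hasSum_jacobiTheta₂_mul _ _ h2).mul_left _).congr_fun fun p => ?_
    simp only [jacobiTheta₂_term, ← Complex.exp_add]
    congr 1
    push_cast
    ring
  exact h.unique (HasSum.sum hl hr)

lemma theta2_two_eq (w τ : ℂ) : theta2 w (2 * τ)
    = cexp (Real.pi * I * τ / 2 + Real.pi * I * w) * theta3 (w + τ) (2 * τ) := by
  rw [theta2_eq, show 2 * τ / 2 = τ by ring]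
  congr 2
  ring

lemma theta2_two_add (w τ : ℂ) : theta2 (w + τ) (2 * τ)
    = cexp (-(Real.pi * I * τ / 2 + Real.pi * I * w)) * theta3 w (2 * τ) := by
  rw [theta2_two_eq, show w + τ + τ = w + 2 * τ by ring, theta3_add_tau, ← mul_assoc,
    ← Complex.exp_add]
  congr 2
  ring

lemma theta2_mul_theta2 (x y : ℂ) {τ : ℂ} (hτ : 0 < τ.im) :
    theta2 x τ * theta2 y τ = theta3 (x + y) (2 * τ) * theta2 (x - y) (2 * τ)
      + theta2 (x + y) (2 * τ) * theta3 (x - y) (2 * τ) := by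
  rw [theta2_eq x τ, theta2_eq y τ, mul_mul_mul_comm, theta3_mul_theta3 _ _ hτ,
    show x + τ / 2 + (y + τ / 2) = x + y + τ by ring,
    show x + τ / 2 - (y + τ / 2) = x - y by ring, theta2_two_add, theta2_two_eq (x + y), mul_add]
  have e : cexp (Real.pi * I * τ / 4 + Real.pi * I * x) * cexp (Real.pi * I * τ / 4 + Real.pi * I * y)
      = cexp (Real.pi * I * τ / 2 + Real.pi * I * (x + y)) := by
    rw [← Complex.exp_add]; congr 1; ring
  have e' := Complex.exp_ne_zero (Real.pi * I * τ / 2 + Real.pi * I * (x + y))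
  rw [e, Complex.exp_neg]
  field_simp
  ring

lemma theta4_mul_theta4 (x y : ℂ) {τ : ℂ} (hτ : 0 < τ.im) :
    theta4 x τ * theta4 y τ = theta3 (x + y) (2 * τ) * theta3 (x - y) (2 * τ)
      - theta2 (x + y) (2 * τ) * theta2 (x - y) (2 * τ) := by
  rw [theta4_eq, theta4_eq, theta3_mul_theta3 _ _ hτ,
    show x + 1 / 2 + (y + 1 / 2) = x + y + 1 by ring,
    show x + 1 / 2 - (y + 1 / 2) = x - y by ring, theta3_add_one, theta2_add_one]
  ring

lemma theta1_mul_theta1 (x y : ℂ) {τ : ℂ} (hτ : 0 < τ.im) :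
    theta1 x τ * theta1 y τ = theta3 (x + y) (2 * τ) * theta2 (x - y) (2 * τ)
      - theta2 (x + y) (2 * τ) * theta3 (x - y) (2 * τ) := by
  rw [theta1_eq, theta1_eq, neg_mul_neg, theta2_mul_theta2 _ _ hτ,
    show x + 1 / 2 + (y + 1 / 2) = x + y + 1 by ring,
    show x + 1 / 2 - (y + 1 / 2) = x - y by ring, theta3_add_one, theta2_add_one]
  ring

lemma theta2_sub_half (w τ : ℂ) : theta2 (w - 1 / 2) τ = theta1 w τ := by
  rw [theta1_eq, show w + 1 / 2 = w - 1 / 2 + 1 by ring, theta2_add_one, neg_neg]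

lemma theta3_sub_half (w τ : ℂ) : theta3 (w - 1 / 2) τ = theta4 w τ := by
  rw [theta4_eq, ← theta3_add_one]
  congr 1; ring

lemma theta2_mul_theta1 (x y : ℂ) {τ : ℂ} (hτ : 0 < τ.im) :
    theta2 x τ * theta1 y τ = theta1 (x + y) (2 * τ) * theta4 (x - y) (2 * τ)
      - theta4 (x + y) (2 * τ) * theta1 (x - y) (2 * τ) := by
  rw [theta1_eq y, mul_neg, theta2_mul_theta2 _ _ hτ, ← add_assoc, ← sub_sub, theta3_sub_half,
    theta2_sub_half, theta4_eq (x + y), theta1_eq (x + y)]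
  ring

lemma theta3_mul_theta4 (x y : ℂ) {τ : ℂ} (hτ : 0 < τ.im) :
    theta3 x τ * theta4 y τ = theta4 (x + y) (2 * τ) * theta4 (x - y) (2 * τ)
      - theta1 (x + y) (2 * τ) * theta1 (x - y) (2 * τ) := by
  rw [theta4_eq y, theta3_mul_theta3 _ _ hτ, ← add_assoc, ← sub_sub, theta3_sub_half,
    theta2_sub_half, theta4_eq (x + y), theta1_eq (x + y)]
  ring

/-! ### Quadratic relations -/

/-- On the diagonal `x = y` all four squares are linear forms in the two functions `θ₃(2z|2τ)`,
`θ₂(2z|2τ)`, so relations between squares reduce to polynomial identities. -/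
lemma theta3_sq {τ : ℂ} (hτ : 0 < τ.im) (z : ℂ) :
    theta3 z τ ^ 2 = theta3 (2 * z) (2 * τ) * theta3 0 (2 * τ)
    + theta2 (2 * z) (2 * τ) * theta2 0 (2 * τ) := by
  rw [sq, theta3_mul_theta3 _ _ hτ, sub_self, two_mul z]

lemma theta4_sq {τ : ℂ} (hτ : 0 < τ.im) (z : ℂ) :
    theta4 z τ ^ 2 = theta3 (2 * z) (2 * τ) * theta3 0 (2 * τ)
    - theta2 (2 * z) (2 * τ) * theta2 0 (2 * τ) := by
  rw [sq, theta4_mul_theta4 _ _ hτ, sub_self, two_mul z]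

lemma theta2_sq {τ : ℂ} (hτ : 0 < τ.im) (z : ℂ) :
    theta2 z τ ^ 2 = theta3 (2 * z) (2 * τ) * theta2 0 (2 * τ)
    + theta2 (2 * z) (2 * τ) * theta3 0 (2 * τ) := by
  rw [sq, theta2_mul_theta2 _ _ hτ, sub_self, two_mul z]

lemma theta1_sq {τ : ℂ} (hτ : 0 < τ.im) (z : ℂ) :
    theta1 z τ ^ 2 = theta3 (2 * z) (2 * τ) * theta2 0 (2 * τ)
    - theta2 (2 * z) (2 * τ) * theta3 0 (2 * τ) := by
  rw [sq, theta1_mul_theta1 _ _ hτ, sub_self, two_mul z]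

lemma theta3_zero_sq {τ : ℂ} (hτ : 0 < τ.im) :
    theta3 0 τ ^ 2 = theta3 0 (2 * τ) ^ 2 + theta2 0 (2 * τ) ^ 2 := by
  rw [theta3_sq hτ, mul_zero]; ring

lemma theta4_zero_sq {τ : ℂ} (hτ : 0 < τ.im) :
    theta4 0 τ ^ 2 = theta3 0 (2 * τ) ^ 2 - theta2 0 (2 * τ) ^ 2 := by
  rw [theta4_sq hτ, mul_zero]; ring

lemma theta2_zero_sq {τ : ℂ} (hτ : 0 < τ.im) :
    theta2 0 τ ^ 2 = 2 * (theta2 0 (2 * τ) * theta3 0 (2 * τ)) := by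
  rw [theta2_sq hτ, mul_zero]; ring

lemma theta3_mul_theta4_self {τ : ℂ} (hτ : 0 < τ.im) (z : ℂ) : theta3 z τ * theta4 z τ
    = theta4 (2 * z) (2 * τ) * theta4 0 (2 * τ) := by
  rw [theta3_mul_theta4 _ _ hτ, sub_self, theta1_zero, two_mul z]; ring

lemma theta_sq_rel24 {τ : ℂ} (hτ : 0 < τ.im) (z : ℂ) :
    theta2 0 τ ^ 2 * theta4 z τ ^ 2 - theta4 0 τ ^ 2 * theta2 z τ ^ 2
    = theta3 0 τ ^ 2 * theta1 z τ ^ 2 := by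
  rw [theta3_zero_sq hτ, theta4_zero_sq hτ, theta2_zero_sq hτ, theta4_sq hτ, theta2_sq hτ,
    theta1_sq hτ]
  ring

lemma theta_sq_rel23 {τ : ℂ} (hτ : 0 < τ.im) (z : ℂ) :
    theta2 0 τ ^ 2 * theta3 z τ ^ 2 - theta3 0 τ ^ 2 * theta2 z τ ^ 2
    = theta4 0 τ ^ 2 * theta1 z τ ^ 2 := by
  rw [theta3_zero_sq hτ, theta4_zero_sq hτ, theta2_zero_sq hτ, theta3_sq hτ, theta2_sq hτ,
    theta1_sq hτ]
  ring

lemma theta_sq_rel34 {τ : ℂ} (hτ : 0 < τ.im) (z : ℂ) :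
    theta3 0 τ ^ 2 * theta4 z τ ^ 2 - theta4 0 τ ^ 2 * theta3 z τ ^ 2
    = theta2 0 τ ^ 2 * theta1 z τ ^ 2 := by
  rw [theta3_zero_sq hτ, theta4_zero_sq hτ, theta2_zero_sq hτ, theta4_sq hτ, theta3_sq hτ,
    theta1_sq hτ]
  ring

lemma theta_zero_pow_four {τ : ℂ} (hτ : 0 < τ.im) :
    theta3 0 τ ^ 4 = theta2 0 τ ^ 4 + theta4 0 τ ^ 4 := by
  have e : ∀ x : ℂ, x ^ 4 = (x ^ 2) ^ 2 := fun x => by ring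
  rw [e, e (theta2 0 τ), e (theta4 0 τ), theta3_zero_sq hτ, theta4_zero_sq hτ, theta2_zero_sq hτ]
  ring

/-! ### Derivatives in `z` -/

lemma differentiable_theta3 {τ : ℂ} (hτ : 0 < τ.im) : Differentiable ℂ (fun w => theta3 w τ) := by
  simp only [theta3_eq]
  exact fun z => differentiableAt_jacobiTheta₂_fst z hτ

lemma differentiable_theta4 {τ : ℂ} (hτ : 0 < τ.im) : Differentiable ℂ (fun w => theta4 w τ) := by
  simp only [theta4_eq]
  exact (differentiable_theta3 hτ).comp (differentiable_id.add_const _)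

lemma differentiable_theta2 {τ : ℂ} (hτ : 0 < τ.im) : Differentiable ℂ (fun w => theta2 w τ) := by
  simp only [theta2_eq]
  exact (by fun_prop : Differentiable ℂ fun w : ℂ => cexp (Real.pi * I * τ / 4 + Real.pi * I * w)).mul
    ((differentiable_theta3 hτ).comp (differentiable_id.add_const _))

lemma differentiable_theta1 {τ : ℂ} (hτ : 0 < τ.im) : Differentiable ℂ (fun w => theta1 w τ) := by
  simp only [theta1_eq]
  exact ((differentiable_theta2 hτ).comp (differentiable_id.add_const _)).neg

/-- The derivative of `θ₂` in `z`. -/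
def dtheta2 (z τ : ℂ) : ℂ := deriv (fun w => theta2 w τ) z

/-- The derivative of `θ₃` in `z`. -/
def dtheta3 (z τ : ℂ) : ℂ := deriv (fun w => theta3 w τ) z

/-- The derivative of `θ₄` in `z`. -/
def dtheta4 (z τ : ℂ) : ℂ := deriv (fun w => theta4 w τ) z

lemma hasDerivAt_theta1 {τ : ℂ} (hτ : 0 < τ.im) (z : ℂ) :
    HasDerivAt (fun w => theta1 w τ) (dtheta1 z τ) z := (differentiable_theta1 hτ z).hasDerivAt

lemma hasDerivAt_theta2 {τ : ℂ} (hτ : 0 < τ.im) (z : ℂ) :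
    HasDerivAt (fun w => theta2 w τ) (dtheta2 z τ) z := (differentiable_theta2 hτ z).hasDerivAt

lemma hasDerivAt_theta3 {τ : ℂ} (hτ : 0 < τ.im) (z : ℂ) :
    HasDerivAt (fun w => theta3 w τ) (dtheta3 z τ) z := (differentiable_theta3 hτ z).hasDerivAt

lemma hasDerivAt_theta4 {τ : ℂ} (hτ : 0 < τ.im) (z : ℂ) :
    HasDerivAt (fun w => theta4 w τ) (dtheta4 z τ) z := (differentiable_theta4 hτ z).hasDerivAt

lemma deriv_zero_of_even {f : ℂ → ℂ} (hf : ∀ z, f (-z) = f z) : deriv f 0 = 0 := by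
  have h := deriv_comp_neg f 0
  simp only [hf, neg_zero] at h
  exact self_eq_neg.mp h

lemma dtheta4_zero (τ : ℂ) : dtheta4 0 τ = 0 :=
  deriv_zero_of_even fun z => theta4_neg z τ

/-- The Wronskian of `θ₂, θ₁`, as a theta function of the doubled argument. -/
lemma wronskian21_eq_double {τ : ℂ} (hτ : 0 < τ.im) (z : ℂ) :
    dtheta2 z τ * theta1 z τ - theta2 z τ * dtheta1 z τ
      = -(2 * dtheta1 0 (2 * τ) * theta4 (2 * z) (2 * τ)) := by
  have h2 := two_mul_im_pos hτ
  have hp : HasDerivAt (fun h : ℂ => z + h) 1 0 := (hasDerivAt_id 0).const_add z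
  have hm : HasDerivAt (fun h : ℂ => z - h) (-1) 0 := (hasDerivAt_id 0).const_sub z
  have hd : HasDerivAt (fun h : ℂ => 2 * h) 2 0 := by simpa using (hasDerivAt_id (0 : ℂ)).const_mul 2
  have e2 : HasDerivAt (fun h => theta2 (z + h) τ) (dtheta2 z τ * 1) 0 :=
    HasDerivAt.comp (h₂ := fun w => theta2 w τ) 0 (by simpa using hasDerivAt_theta2 hτ z) hp
  have e1 : HasDerivAt (fun h => theta1 (z - h) τ) (dtheta1 z τ * (-1)) 0 :=
    HasDerivAt.comp (h₂ := fun w => theta1 w τ) 0 (by simpa using hasDerivAt_theta1 hτ z) hm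
  have d4 : HasDerivAt (fun h => theta4 (2 * h) (2 * τ)) (dtheta4 0 (2 * τ) * 2) 0 :=
    HasDerivAt.comp (h₂ := fun w => theta4 w (2 * τ)) 0
      (by simpa using hasDerivAt_theta4 h2 0) hd
  have d1 : HasDerivAt (fun h => theta1 (2 * h) (2 * τ)) (dtheta1 0 (2 * τ) * 2) 0 :=
    HasDerivAt.comp (h₂ := fun w => theta1 w (2 * τ)) 0
      (by simpa using hasDerivAt_theta1 h2 0) hd
  have hl := e2.mul e1
  have hr := (d4.const_mul (theta1 (2 * z) (2 * τ))).sub (d1.const_mul (theta4 (2 * z) (2 * τ)))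
  -- The product formula at `x = z + h`, `y = z - h` keeps `x + y` fixed. Its `h`-derivative at `0`
  -- is the Wronskian on one side; on the other only the `θ₁'(0)` term survives, since `θ₄` is even.
  have he : ((fun h => theta2 (z + h) τ) * fun h => theta1 (z - h) τ)
      = (fun h => theta1 (2 * z) (2 * τ) * theta4 (2 * h) (2 * τ))
        - fun h => theta4 (2 * z) (2 * τ) * theta1 (2 * h) (2 * τ) := by
    funext h
    simp only [Pi.mul_apply, Pi.sub_apply]
    rw [theta2_mul_theta1 _ _ hτ]
    congr 3 <;> ring
  rw [he] at hl
  have := hl.unique hr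
  rw [dtheta4_zero] at this
  simp only [add_zero, sub_zero] at this
  linear_combination this

lemma dtheta1_zero_double {τ : ℂ} (hτ : 0 < τ.im) :
    theta2 0 τ * dtheta1 0 τ = 2 * dtheta1 0 (2 * τ) * theta4 0 (2 * τ) := by
  have h := wronskian21_eq_double hτ 0
  rw [theta1_zero, mul_zero, mul_zero] at h
  linear_combination -h

/-! ### Behaviour at `i∞` -/

/-- The neighbourhoods of `i∞`. -/
def imTop : Filter ℂ := comap Complex.im atTop

lemma eventually_imTop (y : ℝ) : ∀ᶠ τ in imTop, y ≤ τ.im :=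
  tendsto_comap.eventually (eventually_ge_atTop y)

lemma norm_exp_pi_I_mul (m : ℝ) (τ : ℂ) :
    ‖cexp (Real.pi * I * m * τ)‖ = Real.exp (-(Real.pi * m * τ.im)) := by
  rw [Complex.norm_exp]
  congr 1
  simp

lemma tendsto_exp_imTop {m : ℝ} (hm : 0 < m) :
    Tendsto (fun τ : ℂ => cexp (Real.pi * I * m * τ)) imTop (𝓝 0) := by
  rw [tendsto_zero_iff_norm_tendsto_zero]
  simp only [norm_exp_pi_I_mul]
  refine Real.tendsto_exp_neg_atTop_nhds_zero.comp ?_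
  exact (tendsto_comap : Tendsto Complex.im imTop atTop).const_mul_atTop (by positivity)

/-- Dominated convergence on `Im τ ≥ 1`: the majorant is the series of norms at `τ = i`, so
applications only need summability of a theta series there. The limit keeps the terms with exponent
zero. -/
lemma tendsto_tsum_imTop (c : ℤ → ℂ) (m : ℤ → ℤ) (hm : ∀ n, 0 ≤ m n)
    (hs : Summable fun n => ‖c n‖ * Real.exp (-(Real.pi * m n))) :
    Tendsto (fun τ : ℂ => ∑' n, c n * cexp (Real.pi * I * m n * τ)) imTop
      (𝓝 (∑' n, if m n = 0 then c n else 0)) := by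
  refine tendsto_tsum_of_dominated_convergence hs (fun n => ?_) ?_
  · by_cases h : m n = 0
    · simpa [h] using tendsto_const_nhds
    · have h0 : (0 : ℝ) < m n := by exact_mod_cast lt_of_le_of_ne (hm n) (Ne.symm h)
      simpa [h] using (tendsto_exp_imTop h0).const_mul (c n)
  · filter_upwards [eventually_imTop 1] with τ hτ n
    have h0 : (0 : ℝ) ≤ m n := by exact_mod_cast hm n
    have := norm_exp_pi_I_mul (m n) τ
    rw [norm_mul]
    push_cast at this
    rw [this]
    have : 0 ≤ Real.pi * m n := by positivity
    refine mul_le_mul_of_nonneg_left (Real.exp_le_exp.2 ?_) (norm_nonneg _)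
    nlinarith

lemma im_I_pos : 0 < I.im := by simp

lemma tendsto_theta3_imTop (b : ℝ) : Tendsto (fun τ => theta3 b τ) imTop (𝓝 1) := by
  have h := tendsto_tsum_imTop (fun n => cexp (2 * Real.pi * I * n * b)) (fun n => n ^ 2)
    (fun n => sq_nonneg n) ?_
  · convert h using 2 with τ
    · rw [theta3_eq]
      refine tsum_congr fun n => ?_
      rw [jacobiTheta₂_term, ← Complex.exp_add]
      push_cast; rfl
    · rw [tsum_eq_single 0]
      · simp
      · intro n hn; simp [hn]
  · refine ((summable_jacobiTheta₂_term_iff b I).2 im_I_pos).norm.congr fun n => ?_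
    rw [norm_jacobiTheta₂_term, Complex.norm_exp, ← Real.exp_add]
    congr 1
    simp

lemma int_sq_add_self_nonneg (n : ℤ) : 0 ≤ n ^ 2 + n := by
  rcases le_or_gt 0 n with h | h <;> nlinarith

lemma int_sq_add_self_eq_zero {n : ℤ} : n ^ 2 + n = 0 ↔ n = 0 ∨ n = -1 := by
  rw [show n ^ 2 + n = n * (n + 1) by ring, mul_eq_zero]
  omega

lemma tsum_ite_sq_add_self (c : ℤ → ℂ) :
    ∑' n : ℤ, (if n ^ 2 + n = 0 then c n else 0) = c 0 + c (-1) := by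
  rw [tsum_eq_sum (s := {0, -1})]
  · rw [Finset.sum_pair (by norm_num)]
    simp
  · intro n hn
    simp only [Finset.mem_insert, Finset.mem_singleton] at hn
    rw [if_neg]
    rwa [int_sq_add_self_eq_zero]

/-- At a half-period the exponents are `n² + n`, which vanish for both `n = 0` and `n = -1`; hence
two terms in the limit. -/
lemma tendsto_theta3_half_imTop (b : ℝ) :
    Tendsto (fun τ => theta3 (τ / 2 + b) τ) imTop (𝓝 (1 + cexp (-(2 * Real.pi * I * b)))) := by
  have h := tendsto_tsum_imTop (fun n => cexp (2 * Real.pi * I * n * b)) (fun n => n ^ 2 + n)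
    int_sq_add_self_nonneg ?_
  · rw [tsum_ite_sq_add_self] at h
    convert h using 2 with τ
    · rw [theta3_eq]
      refine tsum_congr fun n => ?_
      rw [jacobiTheta₂_term, ← Complex.exp_add]
      congr 1
      push_cast; ring
    · simp
  · refine ((summable_jacobiTheta₂_term_iff (I / 2 + b) I).2 im_I_pos).norm.congr fun n => ?_
    rw [norm_jacobiTheta₂_term, Complex.norm_exp, ← Real.exp_add]
    congr 1
    simp
    ring

lemma tendsto_jacobiTheta₂'_imTop :
    Tendsto (fun τ => jacobiTheta₂' (τ / 2 + 1 / 2) τ) imTop (𝓝 (2 * Real.pi * I)) := by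
  have h := tendsto_tsum_imTop (fun n => 2 * Real.pi * I * n * cexp (2 * Real.pi * I * n * (1 / 2)))
    (fun n => n ^ 2 + n) int_sq_add_self_nonneg ?_
  · rw [tsum_ite_sq_add_self] at h
    convert h using 2 with τ
    · refine tsum_congr fun n => ?_
      rw [jacobiTheta₂'_term, jacobiTheta₂_term, mul_assoc _ (cexp _) (cexp _), ← Complex.exp_add]
      congr 2
      push_cast; ring
    · have : cexp (2 * Real.pi * I * ((-1 : ℤ) : ℂ) * (1 / 2)) = -1 := by
        rw [show 2 * Real.pi * I * ((-1 : ℤ) : ℂ) * (1 / 2) = -(Real.pi * I) by push_cast; ring,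
          Complex.exp_neg, Complex.exp_pi_mul_I]
        norm_num
      rw [this]
      simp
  · refine ((summable_jacobiTheta₂'_term_iff (I / 2 + 1 / 2) I).2 im_I_pos).norm.congr fun n => ?_
    rw [jacobiTheta₂'_term, norm_mul, norm_jacobiTheta₂_term, norm_mul _ (cexp _), Complex.norm_exp,
      mul_assoc ‖_‖, ← Real.exp_add]
    congr 2
    simp
    ring

lemma theta2_zero_eq (τ : ℂ) : theta2 0 τ = cexp (Real.pi * I * τ / 4) * theta3 (τ / 2) τ := by
  rw [theta2_eq, mul_zero, add_zero, zero_add]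

lemma dtheta1_zero_eq {τ : ℂ} (hτ : 0 < τ.im) :
    dtheta1 0 τ = cexp (Real.pi * I * τ / 4) * (-I * jacobiTheta₂' (τ / 2 + 1 / 2) τ) := by
  have hJ := (hasDerivAt_jacobiTheta₂_fst (0 + 1 / 2 + τ / 2) hτ).comp_add_const (0 + 1/2) (τ / 2)
  have hJ := hJ.comp_add_const 0 (1 / 2)
  have hE : HasDerivAt (fun w : ℂ => cexp (Real.pi * I * τ / 4 + Real.pi * I * (w + 1 / 2)))
      (cexp (Real.pi * I * τ / 4 + Real.pi * I * (0 + 1 / 2)) * (Real.pi * I)) 0 := by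
    have := (((hasDerivAt_id (0 : ℂ)).add_const (1 / 2)).const_mul (Real.pi * I)).const_add
      (Real.pi * I * τ / 4)
    simpa using this.cexp
  have h := (hE.mul hJ).neg
  have h0 := theta1_zero τ
  have he : (fun w => theta1 w τ) = -((fun w : ℂ => cexp (Real.pi * I * τ / 4 + Real.pi * I * (w + 1 / 2)))
      * fun w => jacobiTheta₂ (w + 1 / 2 + τ / 2) τ) := by
    funext w
    simp only [Pi.neg_apply, Pi.mul_apply]
    rw [theta1_eq, theta2_eq, theta3_eq]
  -- Since `θ₁(0) = 0`, the term in which the exponential prefactor is differentiated drops out.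
  have hz : jacobiTheta₂ (0 + 1 / 2 + τ / 2) τ = 0 := by
    rw [theta1_eq, theta2_eq, theta3_eq, neg_eq_zero, mul_eq_zero] at h0
    exact h0.resolve_left (Complex.exp_ne_zero _)
  rw [← he] at h
  rw [dtheta1, h.deriv, hz]
  have : cexp (Real.pi * I * τ / 4 + Real.pi * I * (0 + 1 / 2)) = cexp (Real.pi * I * τ / 4) * I := by
    rw [Complex.exp_add, zero_add, show (Real.pi * I * (1 / 2) : ℂ) = Real.pi / 2 * I by ring,
      Complex.exp_pi_div_two_mul_I]
  rw [this, show 0 + 1 / 2 + τ / 2 = τ / 2 + 1 / 2 by ring]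
  ring

/-! ### Non-vanishing of the theta constants and Jacobi's derivative formula -/

lemma eventually_theta_ne_zero : ∀ᶠ τ in imTop,
    theta2 0 τ ≠ 0 ∧ theta3 0 τ ≠ 0 ∧ theta4 0 τ ≠ 0 := by
  have h3 : ∀ᶠ τ in imTop, theta3 (0 : ℝ) τ ≠ 0 :=
    (tendsto_theta3_imTop 0).eventually_ne one_ne_zero
  have h4 : ∀ᶠ τ in imTop, theta3 (1 / 2 : ℝ) τ ≠ 0 :=
    (tendsto_theta3_imTop (1 / 2)).eventually_ne one_ne_zero
  have h2 : ∀ᶠ τ in imTop, theta3 (τ / 2 + (0 : ℝ)) τ ≠ 0 :=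
    (tendsto_theta3_half_imTop 0).eventually_ne (by norm_num)
  filter_upwards [h2, h3, h4] with τ h2 h3 h4
  refine ⟨?_, by simpa using h3, by simpa [theta4_eq] using h4⟩
  rw [theta2_zero_eq]
  exact mul_ne_zero (Complex.exp_ne_zero _) (by simpa using h2)

lemma theta_ne_zero_of_double {τ : ℂ} (hτ : 0 < τ.im)
    (h : theta2 0 (2 * τ) ≠ 0 ∧ theta3 0 (2 * τ) ≠ 0 ∧ theta4 0 (2 * τ) ≠ 0) :
    theta2 0 τ ≠ 0 ∧ theta3 0 τ ≠ 0 ∧ theta4 0 τ ≠ 0 := by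
  obtain ⟨h2, h3, h4⟩ := h
  have e34 := theta3_mul_theta4_self hτ 0
  rw [mul_zero] at e34
  have e2 := theta2_zero_sq hτ
  have h34 : theta3 0 τ * theta4 0 τ ≠ 0 := by rw [e34]; exact mul_ne_zero h4 h4
  refine ⟨fun h0 => ?_, left_ne_zero_of_mul h34, right_ne_zero_of_mul h34⟩
  rw [h0] at e2
  exact mul_ne_zero two_ne_zero (mul_ne_zero h2 h3) (by rw [← e2]; ring)

lemma im_two_pow_mul (n : ℕ) (τ : ℂ) : (2 ^ n * τ).im = 2 ^ n * τ.im := by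
  have : ((2 : ℂ) ^ n) = ((2 ^ n : ℝ) : ℂ) := by push_cast; rfl
  rw [this, Complex.im_ofReal_mul]

lemma tendsto_two_pow_mul {τ : ℂ} (hτ : 0 < τ.im) :
    Tendsto (fun n : ℕ => 2 ^ n * τ) atTop imTop := by
  refine tendsto_comap_iff.2 ?_
  have : (Complex.im ∘ fun n : ℕ => 2 ^ n * τ) = fun n : ℕ => (2 : ℝ) ^ n * τ.im := by
    funext n; exact im_two_pow_mul n τ
  rw [this]
  exact (tendsto_pow_atTop_atTop_of_one_lt one_lt_two).atTop_mul_const hτ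

/-- The limits at `i∞` give non-vanishing at `2ⁿτ` for some `n`; the duplication formulas `ϑ₃ϑ₄ =
ϑ₄(2τ)²` and `ϑ₂² = 2ϑ₂(2τ)ϑ₃(2τ)` bring it back down to `τ`. -/
lemma theta_ne_zero {τ : ℂ} (hτ : 0 < τ.im) :
    theta2 0 τ ≠ 0 ∧ theta3 0 τ ≠ 0 ∧ theta4 0 τ ≠ 0 := by
  obtain ⟨n, hn⟩ := ((tendsto_two_pow_mul hτ).eventually eventually_theta_ne_zero).exists
  induction n with
  | zero => simpa using hn
  | succ k ih =>
    refine ih (theta_ne_zero_of_double (by rw [im_two_pow_mul]; positivity) ?_)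
    rwa [pow_succ', mul_assoc] at hn

lemma theta2_ne_zero {τ : ℂ} (hτ : 0 < τ.im) : theta2 0 τ ≠ 0 := (theta_ne_zero hτ).1
lemma theta3_ne_zero {τ : ℂ} (hτ : 0 < τ.im) : theta3 0 τ ≠ 0 := (theta_ne_zero hτ).2.1
lemma theta4_ne_zero {τ : ℂ} (hτ : 0 < τ.im) : theta4 0 τ ≠ 0 := (theta_ne_zero hτ).2.2

/-- The product of the three theta constants. -/
def thetaProd (τ : ℂ) : ℂ := theta2 0 τ * theta3 0 τ * theta4 0 τ

lemma thetaProd_ne_zero {τ : ℂ} (hτ : 0 < τ.im) : thetaProd τ ≠ 0 :=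
  mul_ne_zero (mul_ne_zero (theta2_ne_zero hτ) (theta3_ne_zero hτ)) (theta4_ne_zero hτ)

lemma thetaProd_eq (τ : ℂ) : thetaProd τ
    = cexp (Real.pi * I * τ / 4) * (theta3 (τ / 2) τ * theta3 0 τ * theta4 0 τ) := by
  rw [thetaProd, theta2_zero_eq]; ring

lemma tendsto_thetaProd_imTop :
    Tendsto (fun τ => theta3 (τ / 2) τ * theta3 0 τ * theta4 0 τ) imTop (𝓝 2) := by
  have h := ((tendsto_theta3_half_imTop 0).mul (tendsto_theta3_imTop 0)).mul
    (tendsto_theta3_imTop (1 / 2))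
  convert h using 2
  · simp [theta4_eq]
  · norm_num

lemma tendsto_dtheta1_div_thetaProd :
    Tendsto (fun τ => dtheta1 0 τ / thetaProd τ) imTop (𝓝 Real.pi) := by
  have h := (tendsto_jacobiTheta₂'_imTop.const_mul (-I)).div tendsto_thetaProd_imTop two_ne_zero
  have e : -I * (2 * Real.pi * I) / 2 = (Real.pi : ℂ) := by
    linear_combination (-(Real.pi : ℂ)) * I_sq
  rw [e] at h
  refine h.congr' ?_
  filter_upwards [eventually_imTop 1] with τ hτ
  rw [thetaProd_eq, dtheta1_zero_eq (by linarith)]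
  exact (mul_div_mul_left _ _ (Complex.exp_ne_zero _)).symm

lemma dtheta1_div_thetaProd_double {τ : ℂ} (hτ : 0 < τ.im) :
    dtheta1 0 (2 * τ) / thetaProd (2 * τ) = dtheta1 0 τ / thetaProd τ := by
  have e34 := theta3_mul_theta4_self hτ 0
  rw [mul_zero] at e34
  have e2 := theta2_zero_sq hτ
  have e1 := dtheta1_zero_double hτ
  rw [div_eq_div_iff (thetaProd_ne_zero (two_mul_im_pos hτ)) (thetaProd_ne_zero hτ)]
  refine mul_left_cancel₀ (theta2_ne_zero hτ) ?_
  simp only [thetaProd]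
  linear_combination (dtheta1 0 (2 * τ) * theta2 0 τ ^ 2) * e34
    + (dtheta1 0 (2 * τ) * theta4 0 (2 * τ) ^ 2) * e2
    - (theta2 0 (2 * τ) * theta3 0 (2 * τ) * theta4 0 (2 * τ)) * e1

/-- Jacobi's derivative formula `θ₁'(0) = π ϑ₂ ϑ₃ ϑ₄`. -/
lemma dtheta1_zero {τ : ℂ} (hτ : 0 < τ.im) : dtheta1 0 τ = Real.pi * thetaProd τ := by
  -- The quotient is invariant under `τ ↦ 2τ`, so it equals its limit `π` along `2ⁿτ → i∞`.
  have h : ∀ n : ℕ, dtheta1 0 (2 ^ n * τ) / thetaProd (2 ^ n * τ) = dtheta1 0 τ / thetaProd τ := by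
    intro n
    induction n with
    | zero => simp
    | succ k ih =>
      rw [pow_succ', mul_assoc, dtheta1_div_thetaProd_double (by rw [im_two_pow_mul]; positivity), ih]
  have hl := tendsto_dtheta1_div_thetaProd.comp (tendsto_two_pow_mul hτ)
  have hc : ((fun τ => dtheta1 0 τ / thetaProd τ) ∘ fun n : ℕ => 2 ^ n * τ)
      = fun _ => dtheta1 0 τ / thetaProd τ := funext h
  rw [hc] at hl
  exact (div_eq_iff (thetaProd_ne_zero hτ)).1 (tendsto_nhds_unique tendsto_const_nhds hl)

lemma dtheta1_zero_ne_zero {τ : ℂ} (hτ : 0 < τ.im) : dtheta1 0 τ ≠ 0 := by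
  rw [dtheta1_zero hτ]
  exact mul_ne_zero (by exact_mod_cast Real.pi_ne_zero) (thetaProd_ne_zero hτ)

/-! ### The first-order differential relations -/

lemma wronskian21 {τ : ℂ} (hτ : 0 < τ.im) (z : ℂ) :
    dtheta2 z τ * theta1 z τ - theta2 z τ * dtheta1 z τ
      = -(Real.pi * theta2 0 τ ^ 2 * (theta3 z τ * theta4 z τ)) := by
  have h := wronskian21_eq_double hτ z
  have h34 := theta3_mul_theta4_self hτ z
  have e34 := theta3_mul_theta4_self hτ 0
  have hd := dtheta1_zero_double hτ
  rw [mul_zero] at e34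
  rw [h, h34]
  rw [dtheta1_zero hτ, thetaProd] at hd
  refine mul_left_cancel₀ (theta4_ne_zero (two_mul_im_pos hτ)) ?_
  linear_combination (theta4 (2 * z) (2 * τ)) * hd -
    theta4 (2 * z) (2 * τ) * Real.pi * theta2 0 τ ^ 2 * e34

lemma eq_zero_of_mul_eq_zero {f g : ℂ → ℂ} (hf : Differentiable ℂ f) (hg : Differentiable ℂ g)
    (h : ∀ z, f z * g z = 0) {a : ℂ} (ha : g a ≠ 0) (z : ℂ) : f z = 0 := by
  have hA : AnalyticOnNhd ℂ f Set.univ := fun x _ => hf.analyticAt x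
  have hc : ∀ᶠ w in 𝓝 a, f w = 0 := by
    filter_upwards [hg.continuous.continuousAt.eventually_ne ha] with w hw
    exact (mul_eq_zero.1 (h w)).resolve_right hw
  exact congrFun (AnalyticOnNhd.eq_of_eventuallyEq hA (fun x _ => analyticAt_const) hc) z

/-- Differentiating the square relation and inserting the known Wronskian of `f2, f1` gives the
claim multiplied by `f4`. Entire functions have no zero divisors, so a single non-zero value of `f4`
allows the cancellation. -/
lemma wronskian_of_sq_relation {a b c : ℂ} {f1 f2 f3 f4 : ℂ → ℂ} (h1 : Differentiable ℂ f1)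
    (h2 : Differentiable ℂ f2) (h3 : Differentiable ℂ f3) (h4 : Differentiable ℂ f4)
    (hsq : ∀ z, a ^ 2 * f4 z ^ 2 - b ^ 2 * f2 z ^ 2 = c * f1 z ^ 2) (ha : a ≠ 0)
    {m : ℂ} (hw : ∀ z, deriv f2 z * f1 z - f2 z * deriv f1 z = -(m * a ^ 2 * (f3 z * f4 z)))
    {z₀ : ℂ} (hz : f4 z₀ ≠ 0) (z : ℂ) :
    deriv f4 z * f1 z - f4 z * deriv f1 z = -(m * b ^ 2 * (f2 z * f3 z)) := by
  have d1 := (h1.contDiff (n := 2)).differentiable_deriv_two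
  have d4 := (h4.contDiff (n := 2)).differentiable_deriv_two
  have key : ∀ z, (deriv f4 z * f1 z - f4 z * deriv f1 z + m * b ^ 2 * (f2 z * f3 z)) * f4 z = 0 := by
    intro z
    have e : HasDerivAt (fun z => a ^ 2 * f4 z ^ 2 - b ^ 2 * f2 z ^ 2)
        (a ^ 2 * (2 * f4 z * deriv f4 z) - b ^ 2 * (2 * f2 z * deriv f2 z)) z := by
      have := (((h4 z).hasDerivAt.pow 2).const_mul (a ^ 2)).fun_sub
        (((h2 z).hasDerivAt.pow 2).const_mul (b ^ 2))
      simpa using this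
    have e' : HasDerivAt (fun z => c * f1 z ^ 2) (c * (2 * f1 z * deriv f1 z)) z := by
      simpa using ((h1 z).hasDerivAt.pow 2).const_mul c
    rw [funext hsq] at e
    have hd := e.unique e'
    refine mul_left_cancel₀ (pow_ne_zero 2 ha) ?_
    linear_combination ((1 : ℂ) / 2 * f1 z) * hd + b ^ 2 * f2 z * hw z - deriv f1 z * hsq z
  have := eq_zero_of_mul_eq_zero (by fun_prop) h4 key hz z
  linear_combination this

lemma wronskian41 {τ : ℂ} (hτ : 0 < τ.im) (z : ℂ) :
    dtheta4 z τ * theta1 z τ - theta4 z τ * dtheta1 z τ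
      = -(Real.pi * theta4 0 τ ^ 2 * (theta2 z τ * theta3 z τ)) :=
  wronskian_of_sq_relation (differentiable_theta1 hτ) (differentiable_theta2 hτ)
    (differentiable_theta3 hτ) (differentiable_theta4 hτ) (theta_sq_rel24 hτ) (theta2_ne_zero hτ)
    (wronskian21 hτ) (theta4_ne_zero hτ) z

lemma wronskian31 {τ : ℂ} (hτ : 0 < τ.im) (z : ℂ) :
    dtheta3 z τ * theta1 z τ - theta3 z τ * dtheta1 z τ
      = -(Real.pi * theta3 0 τ ^ 2 * (theta2 z τ * theta4 z τ)) :=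
  wronskian_of_sq_relation (differentiable_theta1 hτ) (differentiable_theta2 hτ)
    (differentiable_theta4 hτ) (differentiable_theta3 hτ) (theta_sq_rel23 hτ) (theta2_ne_zero hτ)
    (fun z => by rw [mul_comm (theta4 z τ)]; exact wronskian21 hτ z) (theta3_ne_zero hτ) z

/-! ### The heat equation -/

/-- The derivative of `jacobiTheta₂` in the second variable. -/
def jacobiTheta₂Tau (z τ : ℂ) : ℂ := jacobiTheta₂_fderiv z τ (0, 1)

lemma hasSum_jacobiTheta₂Tau (z : ℂ) {τ : ℂ} (hτ : 0 < τ.im) :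
    HasSum (fun n : ℤ => Real.pi * I * n ^ 2 * jacobiTheta₂_term n z τ) (jacobiTheta₂Tau z τ) := by
  have h := (ContinuousLinearMap.apply ℂ ℂ ((0 : ℂ), (1 : ℂ))).hasSum
    (hasSum_jacobiTheta₂_term_fderiv z hτ)
  refine h.congr_fun fun n => ?_
  simp [jacobiTheta₂_term_fderiv, jacobiTheta₂_term, mul_comm]

lemma jacobiTheta₂_fderiv_apply (z : ℂ) {τ : ℂ} (hτ : 0 < τ.im) (a b : ℂ) :
    jacobiTheta₂_fderiv z τ (a, b) = a * jacobiTheta₂' z τ + b * jacobiTheta₂Tau z τ := by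
  have h1 : HasDerivAt (fun x => jacobiTheta₂ x τ) (jacobiTheta₂_fderiv z τ (1, 0)) z :=
    (((hasFDerivAt_jacobiTheta₂ z hτ).comp z (hasFDerivAt_prodMk_left z τ)).hasDerivAt :)
  rw [h1.unique (hasDerivAt_jacobiTheta₂_fst z hτ) |>.symm, jacobiTheta₂Tau]
  have : ((a, b) : ℂ × ℂ) = a • ((1 : ℂ), (0 : ℂ)) + b • ((0 : ℂ), (1 : ℂ)) := by simp
  rw [this, map_add, map_smul, map_smul, smul_eq_mul, smul_eq_mul]

/-- The moving argument is needed for `θ₂`, which is `θ₃` at `z + τ/2` up to an exponential (`c =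
1/2`); `c = 0` is the plain `τ`-derivative. -/
lemma hasDerivAt_jacobiTheta₂_curve (z₀ c : ℂ) {τ : ℂ} (hτ : 0 < τ.im) :
    HasDerivAt (fun t => jacobiTheta₂ (z₀ + c * t) t)
      (c * jacobiTheta₂' (z₀ + c * τ) τ + jacobiTheta₂Tau (z₀ + c * τ) τ) τ := by
  have hc : HasDerivAt (fun t : ℂ => (z₀ + c * t, t)) (c, 1) τ := by
    refine HasDerivAt.prodMk ?_ (hasDerivAt_id τ)
    simpa using ((hasDerivAt_id τ).const_mul c).const_add z₀
  have h := HasFDerivAt.comp_hasDerivAt (f := fun t : ℂ => (z₀ + c * t, t)) τ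
    (hasFDerivAt_jacobiTheta₂ (z₀ + c * τ) hτ) hc
  rwa [jacobiTheta₂_fderiv_apply _ hτ, one_mul] at h

/-- The heat equation term by term: `(2πin)² = 4πi · πin²`. Differentiation under the sum is
justified by a majorant on a strip `|Im z| < S`. -/
lemma hasDerivAt_jacobiTheta₂' (z : ℂ) {τ : ℂ} (hτ : 0 < τ.im) :
    HasDerivAt (fun w => jacobiTheta₂' w τ) (4 * Real.pi * I * jacobiTheta₂Tau z τ) z := by
  obtain ⟨S, hz⟩ := exists_gt |im z|
  have hVo : IsOpen {u : ℂ | |im u| < S} :=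
    (_root_.continuous_abs.comp continuous_im).isOpen_preimage _ isOpen_Iio
  have hVp : IsPreconnected {u : ℂ | |im u| < S} := by
    refine Convex.isPreconnected ?_
    simpa only [abs_lt] using! (convex_halfSpace_im_gt _).inter (convex_halfSpace_im_lt _)
  have h := hasDerivAt_tsum_of_isPreconnected
    (g := fun (n : ℤ) w => jacobiTheta₂'_term n w τ)
    (g' := fun (n : ℤ) w => 2 * Real.pi * I * n * jacobiTheta₂'_term n w τ)
    (u := fun n : ℤ => 4 * Real.pi ^ 2 *
      ((|n| ^ 2 : ℝ) * Real.exp (-Real.pi * (τ.im * n ^ 2 - 2 * S * |n|))))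
    ((summable_pow_mul_jacobiTheta₂_term_bound S hτ 2).mul_left _) hVo hVp ?_ ?_
    (y₀ := z) hz ((summable_jacobiTheta₂'_term_iff z τ).2 hτ) (y := z) hz
  · have hs := ((hasSum_jacobiTheta₂Tau z hτ).mul_left (4 * Real.pi * I)).tsum_eq
    rw [← hs]
    refine h.congr_deriv (tsum_congr fun n => ?_)
    rw [jacobiTheta₂'_term]
    ring
  · intro n y _
    unfold jacobiTheta₂'_term jacobiTheta₂_term
    have h1 : HasDerivAt (fun w : ℂ => 2 * Real.pi * I * n * w + Real.pi * I * n ^ 2 * τ)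
        (2 * Real.pi * I * n) y := by
      simpa using ((hasDerivAt_id y).const_mul (2 * Real.pi * I * n)).add_const
        (Real.pi * I * n ^ 2 * τ)
    exact (h1.cexp.const_mul (2 * Real.pi * I * n)).congr_deriv (by ring)
  · intro n y hy
    rw [norm_mul]
    have h1 := norm_jacobiTheta₂'_term_le hτ (le_of_lt hy) le_rfl n
    have h2 : ‖2 * (Real.pi : ℂ) * I * n‖ = 2 * Real.pi * |n| := by
      simp [abs_of_pos Real.pi_pos]
    rw [h2]
    calc _ ≤ 2 * Real.pi * |n| * (2 * Real.pi * |n| *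
          Real.exp (-Real.pi * (τ.im * n ^ 2 - 2 * S * |n|))) := by
          refine mul_le_mul_of_nonneg_left ?_ (by positivity)
          exact_mod_cast h1
      _ = _ := by push_cast; ring

lemma hasDerivAt_theta3_tau (z : ℂ) {τ : ℂ} (hτ : 0 < τ.im) :
    HasDerivAt (fun t => theta3 z t) (jacobiTheta₂Tau z τ) τ := by
  simpa [theta3_eq] using hasDerivAt_jacobiTheta₂_curve z 0 hτ

lemma dtheta3_eq (z : ℂ) {τ : ℂ} (hτ : 0 < τ.im) : dtheta3 z τ = jacobiTheta₂' z τ := by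
  unfold dtheta3
  simp only [theta3_eq]
  exact (hasDerivAt_jacobiTheta₂_fst z hτ).deriv

/-- The heat equation for `θ₃`. -/
lemma hasDerivAt_theta3_tau_heat (z : ℂ) {τ : ℂ} (hτ : 0 < τ.im) :
    HasDerivAt (fun t => theta3 z t) (deriv (fun w => dtheta3 w τ) z / (4 * Real.pi * I)) τ := by
  convert hasDerivAt_theta3_tau z hτ using 1
  have : (fun w => dtheta3 w τ) = fun w => jacobiTheta₂' w τ := funext fun w => dtheta3_eq w hτ
  rw [this, (hasDerivAt_jacobiTheta₂' z hτ).deriv]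
  have := Real.pi_ne_zero
  field_simp

lemma hasDerivAt_theta2_exp (z τ : ℂ) :
    HasDerivAt (fun w : ℂ => cexp (Real.pi * I * τ / 4 + Real.pi * I * w))
      (cexp (Real.pi * I * τ / 4 + Real.pi * I * z) * (Real.pi * I)) z := by
  simpa using (((hasDerivAt_id z).const_mul (Real.pi * I)).const_add (Real.pi * I * τ / 4)).cexp

lemma dtheta2_eq (z : ℂ) {τ : ℂ} (hτ : 0 < τ.im) : dtheta2 z τ
    = cexp (Real.pi * I * τ / 4 + Real.pi * I * z)
      * (Real.pi * I * jacobiTheta₂ (z + τ / 2) τ + jacobiTheta₂' (z + τ / 2) τ) := by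
  unfold dtheta2
  simp only [theta2_eq, theta3_eq]
  have h := (hasDerivAt_theta2_exp z τ).fun_mul
    ((hasDerivAt_jacobiTheta₂_fst (z + τ / 2) hτ).comp_add_const z (τ / 2))
  rw [h.deriv]
  ring

/-- The heat equation for `θ₂`. -/
lemma hasDerivAt_theta2_tau_heat (z : ℂ) {τ : ℂ} (hτ : 0 < τ.im) :
    HasDerivAt (fun t => theta2 z t) (deriv (fun w => dtheta2 w τ) z / (4 * Real.pi * I)) τ := by
  have hE : HasDerivAt (fun t : ℂ => cexp (Real.pi * I * t / 4 + Real.pi * I * z))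
      (cexp (Real.pi * I * τ / 4 + Real.pi * I * z) * (Real.pi * I / 4)) τ := by
    simpa using ((((hasDerivAt_id τ).const_mul (Real.pi * I)).div_const 4).add_const
      (Real.pi * I * z)).cexp
  have hJ := hasDerivAt_jacobiTheta₂_curve z (1 / 2) hτ
  have h1 := hE.fun_mul hJ
  have h2 := (hasDerivAt_theta2_exp z τ).fun_mul
    ((((hasDerivAt_jacobiTheta₂_fst (z + τ / 2) hτ).comp_add_const z (τ / 2)).const_mul
      (Real.pi * I)).fun_add ((hasDerivAt_jacobiTheta₂' (z + τ / 2) hτ).comp_add_const z (τ / 2)))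
  have e1 : (fun t => theta2 z t) = fun t => cexp (Real.pi * I * t / 4 + Real.pi * I * z)
      * jacobiTheta₂ (z + 1 / 2 * t) t := by
    funext t
    rw [theta2_eq, theta3_eq]
    congr 2; ring
  have e2 : (fun w => dtheta2 w τ) = fun w => cexp (Real.pi * I * τ / 4 + Real.pi * I * w)
      * (Real.pi * I * jacobiTheta₂ (w + τ / 2) τ + jacobiTheta₂' (w + τ / 2) τ) :=
    funext fun w => dtheta2_eq w hτ
  rw [e1, e2, h2.deriv]
  refine h1.congr_deriv ?_
  rw [show z + 1 / 2 * τ = z + τ / 2 by ring]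
  have hpi : (Real.pi : ℂ) ≠ 0 := by exact_mod_cast Real.pi_ne_zero
  rw [eq_div_iff (by simp [hpi])]
  ring

lemma hasDerivAt_theta4_zero_tau {τ : ℂ} (hτ : 0 < τ.im) :
    HasDerivAt (fun t => theta4 0 t) (jacobiTheta₂Tau (1 / 2) τ) τ := by
  simpa [theta4_eq] using hasDerivAt_theta3_tau (1 / 2) hτ

/-! ### Modular transformations -/

lemma exp_int_sq (n : ℤ) : cexp (Real.pi * I * n ^ 2) = cexp (Real.pi * I * n) := by
  have h := int_sq_add_self_nonneg n
  obtain ⟨k, hk⟩ : ∃ k : ℤ, n ^ 2 - n = 2 * k := by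
    obtain ⟨k, hk⟩ := Int.even_mul_pred_self n
    exact ⟨k, by linarith⟩
  have hk' : (n : ℂ) ^ 2 = n + 2 * k := by
    have : ((n ^ 2 - n : ℤ) : ℂ) = ((2 * k : ℤ) : ℂ) := by rw [hk]
    push_cast at this
    linear_combination this
  rw [hk', show (Real.pi * I * (n + 2 * k) : ℂ) = Real.pi * I * n + k * (2 * Real.pi * I) by ring,
    Complex.exp_add, Complex.exp_int_mul_two_pi_mul_I, mul_one]

lemma theta3_tau_add_one (z τ : ℂ) : theta3 z (τ + 1) = theta4 z τ := by
  rw [theta4_eq, theta3_eq, theta3_eq]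
  refine tsum_congr fun n => ?_
  rw [jacobiTheta₂_term, jacobiTheta₂_term,
    show 2 * (Real.pi : ℂ) * I * n * z + Real.pi * I * n ^ 2 * (τ + 1)
      = 2 * Real.pi * I * n * z + Real.pi * I * n ^ 2 * τ + Real.pi * I * n ^ 2 by ring,
    Complex.exp_add, exp_int_sq, ← Complex.exp_add]
  congr 1
  ring

lemma theta4_tau_add_one (z τ : ℂ) : theta4 z (τ + 1) = theta3 z τ := by
  rw [theta4_eq, theta3_tau_add_one, theta4_eq, show z + 1 / 2 + 1 / 2 = z + 1 by ring,
    theta3_add_one]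

lemma theta2_zero_tau_add_one (τ : ℂ) :
    theta2 0 (τ + 1) = cexp (Real.pi * I / 4) * theta2 0 τ := by
  rw [theta2_zero_eq, theta2_zero_eq, theta3_tau_add_one, theta4_eq,
    show (τ + 1) / 2 + 1 / 2 = τ / 2 + 1 by ring, theta3_add_one, ← mul_assoc, ← Complex.exp_add]
  congr 2
  ring

/-- The automorphy factor `√(-iτ)`. -/
def sqrtFactor (τ : ℂ) : ℂ := (-I * τ) ^ (1 / 2 : ℂ)

lemma ne_zero_of_im_pos {τ : ℂ} (hτ : 0 < τ.im) : τ ≠ 0 := by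
  rintro rfl; simp at hτ

lemma sqrtFactor_ne_zero {τ : ℂ} (hτ : 0 < τ.im) : sqrtFactor τ ≠ 0 := by
  rw [sqrtFactor, Ne, Complex.cpow_eq_zero_iff]
  simp [ne_zero_of_im_pos hτ]

lemma sqrtFactor_sq (τ : ℂ) : sqrtFactor τ ^ 2 = -I * τ := by
  rw [sqrtFactor, one_div]
  exact Complex.cpow_ofNat_inv_pow _ 2

lemma neg_one_div_im_pos {τ : ℂ} (hτ : 0 < τ.im) : 0 < (-1 / τ).im := by
  have h := normSq_pos.2 (ne_zero_of_im_pos hτ)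
  rw [show -1 / τ = -τ⁻¹ by ring, neg_im, inv_im]
  simp only [neg_div, neg_neg]
  positivity

lemma sqrtFactor_neg_one_div {τ : ℂ} (hτ : 0 < τ.im) :
    sqrtFactor (-1 / τ) = (sqrtFactor τ)⁻¹ := by
  rw [sqrtFactor, sqrtFactor, ← Complex.inv_cpow]
  · congr 1
    have := ne_zero_of_im_pos hτ
    field_simp
    exact I_sq
  · have : 0 < (-I * τ).re := by simpa using hτ
    intro h
    rw [Complex.arg_eq_pi_iff] at h
    linarith [h.1]

lemma theta3_zero_neg_one_div {τ : ℂ} (hτ : 0 < τ.im) :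
    theta3 0 (-1 / τ) = sqrtFactor τ * theta3 0 τ := by
  have h := jacobiTheta₂_functional_equation 0 τ
  have hs := sqrtFactor_ne_zero hτ
  rw [theta3_eq, theta3_eq, h, ← sqrtFactor]
  simp
  field_simp

lemma theta2_zero_neg_one_div {τ : ℂ} (hτ : 0 < τ.im) :
    theta2 0 (-1 / τ) = sqrtFactor τ * theta4 0 τ := by
  have h := jacobiTheta₂_functional_equation (1 / 2) τ
  have hs := sqrtFactor_ne_zero hτ
  have h0 := ne_zero_of_im_pos hτ
  rw [theta4_eq, theta2_zero_eq, ← theta3_neg, theta3_eq, theta3_eq, zero_add, h, ← sqrtFactor,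
    show -(-1 / τ / 2) = 1 / 2 / τ by ring,
    show (Real.pi * I * (-1 / τ) / 4 : ℂ) = -Real.pi * I * (1 / 2) ^ 2 / τ by ring]
  field_simp

lemma neg_one_div_neg_one_div (τ : ℂ) : -1 / (-1 / τ) = τ := by
  rw [div_div_eq_mul_div]; simp

lemma theta4_zero_neg_one_div {τ : ℂ} (hτ : 0 < τ.im) :
    theta4 0 (-1 / τ) = sqrtFactor τ * theta2 0 τ := by
  have h := theta2_zero_neg_one_div (neg_one_div_im_pos hτ)
  have hs := sqrtFactor_ne_zero hτ
  rw [neg_one_div_neg_one_div, sqrtFactor_neg_one_div hτ] at h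
  rw [h]
  field_simp

lemma thetaProd_add_one (τ : ℂ) :
    thetaProd (τ + 1) = cexp (Real.pi * I / 4) * thetaProd τ := by
  rw [thetaProd, thetaProd, theta2_zero_tau_add_one, theta3_tau_add_one, theta4_tau_add_one]
  ring

lemma thetaProd_neg_one_div {τ : ℂ} (hτ : 0 < τ.im) :
    thetaProd (-1 / τ) = sqrtFactor τ ^ 3 * thetaProd τ := by
  rw [thetaProd, thetaProd, theta2_zero_neg_one_div hτ, theta3_zero_neg_one_div hτ,
    theta4_zero_neg_one_div hτ]
  ring

/-! ### The product of theta constants and the Dedekind function -/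

lemma eta_add_one (τ : ℂ) :
    ModularForm.eta (τ + 1) = cexp (Real.pi * I / 12) * ModularForm.eta τ := by
  have h1 : Function.Periodic.qParam 1 (τ + 1) = Function.Periodic.qParam 1 τ := by
    rw [Function.Periodic.qParam, Function.Periodic.qParam, ofReal_one, div_one, div_one, mul_add,
      mul_one, Complex.exp_add, Complex.exp_two_pi_mul_I, mul_one]
  have h2 : Function.Periodic.qParam 24 (τ + 1)
      = cexp (Real.pi * I / 12) * Function.Periodic.qParam 24 τ := by
    rw [Function.Periodic.qParam, Function.Periodic.qParam, ← Complex.exp_add]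
    congr 1
    push_cast
    ring
  simp only [ModularForm.eta, ModularForm.eta_q, h1, h2]
  ring

lemma sqrt_I_inv_mul_sqrt {τ : ℂ} (hτ : 0 < τ.im) :
    (Complex.sqrt I)⁻¹ * Complex.sqrt τ = sqrtFactor τ := by
  have h0 := ne_zero_of_im_pos hτ
  have hpi := Real.pi_pos
  rw [sqrt_eq_exp I_ne_zero, sqrt_eq_exp h0, sqrtFactor,
    Complex.cpow_def_of_ne_zero (by simp [h0]), ← Complex.exp_neg, ← Complex.exp_add]
  -- No branch correction occurs: `arg τ ∈ [0, π]` and `arg (-i) = -π/2`, so the arguments add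
  -- inside `(-π, π]`.
  have hl : log (-I * τ) = log (-I) + log τ := by
    rw [Complex.log_mul_eq_add_log_iff (by simp) h0, Complex.arg_neg_I]
    have h1 := (Complex.arg_nonneg_iff.2 hτ.le)
    have h2 := Complex.arg_le_pi τ
    constructor <;> linarith
  rw [hl, Complex.log_neg_I, Complex.log_I]
  congr 1
  ring

lemma eta_neg_one_div {τ : ℂ} (hτ : 0 < τ.im) :
    ModularForm.eta (-1 / τ) = sqrtFactor τ * ModularForm.eta τ := by
  have h := ModularForm.eta_comp_eq_csqrt_I_inv hτ
  rw [← sqrt_I_inv_mul_sqrt hτ]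
  simpa [mul_assoc] using h

/-- The quotient of `ϑ₂ϑ₃ϑ₄` and the cube of the Dedekind function. -/
def thetaEtaQuot (τ : ℂ) : ℂ := thetaProd τ / ModularForm.eta τ ^ 3

lemma thetaEtaQuot_add_one (τ : ℂ) : thetaEtaQuot (τ + 1) = thetaEtaQuot τ := by
  rw [thetaEtaQuot, thetaEtaQuot, thetaProd_add_one, eta_add_one, mul_pow, ← Complex.exp_nat_mul,
    show ((3 : ℕ) * (Real.pi * I / 12) : ℂ) = Real.pi * I / 4 by push_cast; ring]
  exact mul_div_mul_left _ _ (Complex.exp_ne_zero _)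

lemma thetaEtaQuot_neg_one_div {τ : ℂ} (hτ : 0 < τ.im) :
    thetaEtaQuot (-1 / τ) = thetaEtaQuot τ := by
  rw [thetaEtaQuot, thetaEtaQuot, thetaProd_neg_one_div hτ, eta_neg_one_div hτ, mul_pow]
  exact mul_div_mul_left _ _ (pow_ne_zero 3 (sqrtFactor_ne_zero hτ))

lemma differentiableAt_thetaProd {τ : ℂ} (hτ : 0 < τ.im) : DifferentiableAt ℂ thetaProd τ :=
  (((hasDerivAt_theta2_tau_heat 0 hτ).differentiableAt.mul
    (hasDerivAt_theta3_tau 0 hτ).differentiableAt).mul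
    (hasDerivAt_theta4_zero_tau hτ).differentiableAt)

lemma differentiableAt_thetaEtaQuot {τ : ℂ} (hτ : 0 < τ.im) : DifferentiableAt ℂ thetaEtaQuot τ :=
  (differentiableAt_thetaProd hτ).div
    ((ModularForm.differentiableAt_eta_of_mem_upperHalfPlaneSet hτ).pow 3)
    (pow_ne_zero 3 (ModularForm.eta_ne_zero hτ))

lemma tendsto_qParam_imTop :
    Tendsto (fun τ : ℂ => Function.Periodic.qParam 1 τ) imTop (𝓝 0) := by
  refine (tendsto_exp_imTop two_pos).congr fun τ => ?_
  rw [Function.Periodic.qParam]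
  congr 1
  push_cast
  ring

lemma tendsto_tprod_one_sub_pow :
    Tendsto (fun q : ℂ => ∏' (n : ℕ), (1 - q ^ (n + 1))) (𝓝 0) (𝓝 1) := by
  have h : ContinuousAt (fun q : ℂ => ∏' (n : ℕ), (1 - q ^ (n + 1))) 0 :=
    (ModularForm.differentiableOn_tprod_one_sub_pow.differentiableAt
      (Metric.ball_mem_nhds (0 : ℂ) one_pos)).continuousAt
  simpa [ContinuousAt] using h

lemma tendsto_thetaEtaQuot : Tendsto thetaEtaQuot imTop (𝓝 2) := by
  have h := tendsto_thetaProd_imTop.div ((tendsto_tprod_one_sub_pow.comp tendsto_qParam_imTop).pow 3)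
    (by norm_num)
  rw [one_pow, div_one] at h
  refine h.congr fun τ => ?_
  -- The leading factor of the cube of the Dedekind function is that of `ϑ₂`, so the quotient has a
  -- finite limit.
  have hq : Function.Periodic.qParam 24 τ ^ 3 = cexp (Real.pi * I * τ / 4) := by
    rw [Function.Periodic.qParam, ← Complex.exp_nat_mul]
    congr 1
    push_cast
    ring
  rw [thetaEtaQuot, thetaProd_eq, ModularForm.eta, mul_pow, hq]
  exact (mul_div_mul_left _ _ (Complex.exp_ne_zero _)).symm

open UpperHalfPlane ModularForm MatrixGroups in
lemma thetaEtaQuot_slash (γ : SL(2, ℤ)) :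
    (fun τ : ℍ => thetaEtaQuot τ) ∣[(0 : ℤ)] γ = fun τ : ℍ => thetaEtaQuot τ := by
  refine SlashInvariantForm.slash_action_generators_SL2Z ?_ ?_ γ
  · ext z
    rw [SL_slash_apply, UpperHalfPlane.modular_S_smul]
    have := thetaEtaQuot_neg_one_div z.2
    rw [neg_div, one_div] at this
    simpa using this
  · ext z
    rw [SL_slash_apply, UpperHalfPlane.modular_T_smul]
    simpa [add_comm] using thetaEtaQuot_add_one z

lemma tendsto_coe_atImInfty :
    Tendsto (fun τ : UpperHalfPlane => (τ : ℂ)) UpperHalfPlane.atImInfty imTop :=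
  tendsto_comap_iff.2 tendsto_comap

open UpperHalfPlane MatrixGroups in
/-- The quotient of `ϑ₂ϑ₃ϑ₄` and the cube of the Dedekind function as a modular form of weight
zero. -/
def thetaEtaQuotForm : ModularForm 𝒮ℒ 0 where
  toFun τ := thetaEtaQuot τ
  slash_action_eq' A hA := by
    obtain ⟨A, rfl⟩ := hA
    exact thetaEtaQuot_slash A
  holo' := by
    rw [UpperHalfPlane.mdifferentiable_iff]
    refine .congr (fun z hz => (differentiableAt_thetaEtaQuot hz).differentiableWithinAt)
      fun z hz => ?_
    simp [ofComplex_apply_of_im_pos hz]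
  -- Every cusp is an `SL(2, ℤ)`-translate of `i∞`, and the quotient is invariant, so the limit at
  -- `i∞` bounds it at all cusps.
  bdd_at_cusps' hc := by
    rw [Subgroup.IsArithmetic.isCusp_iff_isCusp_SL2Z] at hc
    rw [OnePoint.isBoundedAt_iff_forall_SL2Z hc]
    intro γ _
    rw [thetaEtaQuot_slash]
    exact (tendsto_thetaEtaQuot.comp tendsto_coe_atImInfty).isBigO_one ℝ

lemma thetaProd_eq_eta {τ : ℂ} (hτ : 0 < τ.im) : thetaProd τ = 2 * ModularForm.eta τ ^ 3 := by
  obtain ⟨c, hc⟩ := ModularFormClass.levelOne_weight_zero_const thetaEtaQuotForm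
  have hc' : ∀ t : UpperHalfPlane, thetaEtaQuot t = c := fun t => congrFun hc t
  have hl := tendsto_thetaEtaQuot.comp tendsto_coe_atImInfty
  have e : (thetaEtaQuot ∘ fun τ : UpperHalfPlane => (τ : ℂ)) = fun _ => c := funext hc'
  rw [e] at hl
  have h2 : c = 2 := tendsto_nhds_unique tendsto_const_nhds hl
  have := hc' ⟨τ, hτ⟩
  rw [h2, thetaEtaQuot] at this
  exact (div_eq_iff (pow_ne_zero 3 (ModularForm.eta_ne_zero hτ))).1 this

/-! ### The Weierstrass function as an Eisenstein series -/

-- Expand `x / (1 - x)² = ∑ c xᶜ` at `x = r^(k+1)` and collect equal powers of `r`: the coefficients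
-- are divisor sums. This identifies `etaW` with a multiple of `E2`.
open scoped ArithmeticFunction.sigma in
lemma tsum_div_one_sub_sq {r : ℂ} (hr : ‖r‖ < 1) :
    ∑' k : ℕ, r ^ (k + 1) / (1 - r ^ (k + 1)) ^ 2 = ∑' n : ℕ+, (σ 1 n : ℂ) * r ^ (n : ℕ) := by
  have h := tsum_prod_pow_eq_tsum_sigma 1 hr
  rw [← h, tsum_pnat_eq_tsum_succ (f := fun d => ∑' c : ℕ+, (c : ℂ) ^ 1 * r ^ (d * c : ℕ))]
  refine tsum_congr fun k => ?_
  have hk : ‖r ^ (k + 1)‖ < 1 := by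
    rw [norm_pow]; exact pow_lt_one₀ (norm_nonneg _) hr (by omega)
  rw [← tsum_coe_mul_geometric_of_norm_lt_one hk, ← tsum_zero_pnat_eq_tsum_nat]
  · simp [pow_mul]
  · exact (hasSum_coe_mul_geometric_of_norm_lt_one hk).summable

lemma etaW_eq_E2 (τ : UpperHalfPlane) :
    etaW τ = Real.pi ^ 2 / 12 * EisensteinSeries.E2 τ := by
  have h := tsum_div_one_sub_sq (UpperHalfPlane.norm_exp_two_pi_I_lt_one τ)
  rw [etaW, EisensteinSeries.E2_eq_tsum_cexp]
  rw [← h]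
  have : ∀ k : ℕ, cexp (2 * (k + 1) * Real.pi * I * τ) = cexp (2 * Real.pi * I * τ) ^ (k + 1) := by
    intro k
    rw [← Complex.exp_nat_mul]
    congr 1
    push_cast
    ring
  simp only [this]
  ring

lemma hasDerivAt_eta {τ : ℂ} (hτ : 0 < τ.im) :
    HasDerivAt ModularForm.eta (I / Real.pi * etaW τ * ModularForm.eta τ) τ := by
  have h := ModularForm.logDeriv_eta_eq_E2 ⟨τ, hτ⟩
  have hη := ModularForm.eta_ne_zero (z := τ) hτ
  have hE := etaW_eq_E2 ⟨τ, hτ⟩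
  have hd := (ModularForm.differentiableAt_eta_of_mem_upperHalfPlaneSet (z := τ) hτ).hasDerivAt
  rw [logDeriv_apply, div_eq_iff hη] at h
  simp only at h hE
  refine hd.congr_deriv ?_
  rw [h, hE]
  have hpi : (Real.pi : ℂ) ≠ 0 := by exact_mod_cast Real.pi_ne_zero
  field_simp

/-! ### The second-order relation -/

lemma differentiable_dtheta1 {τ : ℂ} (hτ : 0 < τ.im) : Differentiable ℂ (fun w => dtheta1 w τ) :=
  ((differentiable_theta1 hτ).contDiff (n := 2)).differentiable_deriv_two

lemma differentiable_dtheta2 {τ : ℂ} (hτ : 0 < τ.im) : Differentiable ℂ (fun w => dtheta2 w τ) :=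
  ((differentiable_theta2 hτ).contDiff (n := 2)).differentiable_deriv_two

lemma differentiable_dtheta3 {τ : ℂ} (hτ : 0 < τ.im) : Differentiable ℂ (fun w => dtheta3 w τ) :=
  ((differentiable_theta3 hτ).contDiff (n := 2)).differentiable_deriv_two

lemma hasDerivAt_comp_add {f : ℂ → ℂ} {f' z h : ℂ} (hf : HasDerivAt f f' (z + h)) :
    HasDerivAt (fun x => f (z + x)) f' h := hf.comp_const_add z h

lemma hasDerivAt_comp_sub {f : ℂ → ℂ} {f' z h : ℂ} (hf : HasDerivAt f f' (z - h)) :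
    HasDerivAt (fun x => f (z - x)) (-f') h := hf.comp_const_sub z h

lemma hasDerivAt_comp_two_mul {f : ℂ → ℂ} {f' h : ℂ} (hf : HasDerivAt f f' (2 * h)) :
    HasDerivAt (fun x => f (2 * x)) (2 * f') h := by
  have hd : HasDerivAt (fun h : ℂ => 2 * h) 2 h := by simpa using (hasDerivAt_id h).const_mul 2
  have := HasDerivAt.comp (h₂ := f) h hf hd
  rwa [mul_comm]

/-- The second `h`-derivative at `0` of the product formula for `θ₁(z + h) θ₁(z - h)`, in which `h`
enters the right side only through `θ₂` and `θ₃` at `2h`. -/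
lemma second_order_double {τ : ℂ} (hτ : 0 < τ.im) (z : ℂ) :
    deriv (fun w => dtheta1 w τ) z * theta1 z τ - dtheta1 z τ ^ 2
      = 2 * (deriv (fun w => dtheta2 w (2 * τ)) 0 * theta3 (2 * z) (2 * τ)
        - deriv (fun w => dtheta3 w (2 * τ)) 0 * theta2 (2 * z) (2 * τ)) := by
  have h2 := two_mul_im_pos hτ
  have he : (fun h => theta1 (z + h) τ * theta1 (z - h) τ)
      = fun h => theta3 (2 * z) (2 * τ) * theta2 (2 * h) (2 * τ)
        - theta2 (2 * z) (2 * τ) * theta3 (2 * h) (2 * τ) := by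
    funext h
    rw [theta1_mul_theta1 _ _ hτ]
    congr 3 <;> ring
  have hd : (fun h => dtheta1 (z + h) τ * theta1 (z - h) τ
        + theta1 (z + h) τ * -dtheta1 (z - h) τ)
      = fun h => theta3 (2 * z) (2 * τ) * (2 * dtheta2 (2 * h) (2 * τ))
        - theta2 (2 * z) (2 * τ) * (2 * dtheta3 (2 * h) (2 * τ)) := by
    funext h
    have hl := (hasDerivAt_comp_add (hasDerivAt_theta1 hτ (z + h))).fun_mul
      (hasDerivAt_comp_sub (hasDerivAt_theta1 hτ (z - h)))
    have hr := ((hasDerivAt_comp_two_mul (hasDerivAt_theta2 h2 (2 * h))).const_mul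
      (theta3 (2 * z) (2 * τ))).fun_sub ((hasDerivAt_comp_two_mul
        (hasDerivAt_theta3 h2 (2 * h))).const_mul (theta2 (2 * z) (2 * τ)))
    rw [he] at hl
    exact hl.unique hr
  have dd1 := fun w => (differentiable_dtheta1 hτ w).hasDerivAt
  have dd2 := (differentiable_dtheta2 h2 (2 * 0)).hasDerivAt
  have dd3 := (differentiable_dtheta3 h2 (2 * 0)).hasDerivAt
  have hl := ((hasDerivAt_comp_add (h := 0) (dd1 (z + 0))).fun_mul
      (hasDerivAt_comp_sub (h := 0) (hasDerivAt_theta1 hτ (z - 0)))).fun_add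
    ((hasDerivAt_comp_add (h := 0) (hasDerivAt_theta1 hτ (z + 0))).fun_mul
      (hasDerivAt_comp_sub (h := 0) (dd1 (z - 0))).fun_neg)
  have hr := (((hasDerivAt_comp_two_mul (h := 0) dd2).const_mul 2).const_mul
      (theta3 (2 * z) (2 * τ))).fun_sub (((hasDerivAt_comp_two_mul (h := 0) dd3).const_mul 2).const_mul (theta2 (2 * z) (2 * τ)))
  rw [hd] at hl
  have := hl.unique hr
  simp only [add_zero, sub_zero, mul_zero] at this
  linear_combination this / 2

lemma hasDerivAt_theta2_two_tau {τ : ℂ} (hτ : 0 < τ.im) : HasDerivAt (fun t => theta2 0 (2 * t))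
    (2 * (deriv (fun w => dtheta2 w (2 * τ)) 0 / (4 * Real.pi * I))) τ :=
  hasDerivAt_comp_two_mul (f := fun t => theta2 0 t)
    (hasDerivAt_theta2_tau_heat 0 (two_mul_im_pos hτ))

lemma hasDerivAt_theta3_two_tau {τ : ℂ} (hτ : 0 < τ.im) : HasDerivAt (fun t => theta3 0 (2 * t))
    (2 * (deriv (fun w => dtheta3 w (2 * τ)) 0 / (4 * Real.pi * I))) τ :=
  hasDerivAt_comp_two_mul (f := fun t => theta3 0 t)
    (hasDerivAt_theta3_tau_heat 0 (two_mul_im_pos hτ))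

lemma eventually_im_pos {τ : ℂ} (hτ : 0 < τ.im) : ∀ᶠ t in 𝓝 τ, 0 < t.im :=
  (isOpen_lt continuous_const continuous_im).mem_nhds hτ

/-- The sum of the logarithmic derivatives of the theta constants. -/
lemma theta_log_deriv_sum {τ : ℂ} (hτ : 0 < τ.im) :
    deriv (fun t => theta2 0 t) τ / theta2 0 τ + deriv (fun t => theta3 0 t) τ / theta3 0 τ
      + deriv (fun t => theta4 0 t) τ / theta4 0 τ = 3 * (I / Real.pi * etaW τ) := by
  have d2 := (hasDerivAt_theta2_tau_heat 0 hτ).differentiableAt.hasDerivAt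
  have d3 := (hasDerivAt_theta3_tau 0 hτ).differentiableAt.hasDerivAt
  have d4 := (hasDerivAt_theta4_zero_tau hτ).differentiableAt.hasDerivAt
  have hl := (d2.fun_mul d3).fun_mul d4
  have hr : HasDerivAt (fun t => 2 * ModularForm.eta t ^ 3)
      (2 * (3 * ModularForm.eta τ ^ 2 * (I / Real.pi * etaW τ * ModularForm.eta τ))) τ := by
    simpa using ((hasDerivAt_eta hτ).pow 3).const_mul 2
  have he : (fun t => theta2 0 t * theta3 0 t * theta4 0 t)
      =ᶠ[𝓝 τ] fun t => 2 * ModularForm.eta t ^ 3 := by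
    filter_upwards [eventually_im_pos hτ] with t ht
    exact thetaProd_eq_eta ht
  have hu := hl.unique (hr.congr_of_eventuallyEq he)
  have h2 := theta2_ne_zero hτ
  have h3 := theta3_ne_zero hτ
  have h4 := theta4_ne_zero hτ
  have hp := thetaProd_eq_eta hτ
  rw [thetaProd] at hp
  have : theta2 0 τ * theta3 0 τ * theta4 0 τ *
      (deriv (fun t => theta2 0 t) τ / theta2 0 τ + deriv (fun t => theta3 0 t) τ / theta3 0 τ
      + deriv (fun t => theta4 0 t) τ / theta4 0 τ)
      = theta2 0 τ * theta3 0 τ * theta4 0 τ * (3 * (I / Real.pi * etaW τ)) := by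
    rw [hp]
    calc _ = deriv (fun t => theta2 0 t) τ * (theta3 0 τ * theta4 0 τ)
          + deriv (fun t => theta3 0 t) τ * (theta2 0 τ * theta4 0 τ)
          + deriv (fun t => theta4 0 t) τ * (theta2 0 τ * theta3 0 τ) := by
          rw [← hp]; field_simp
      _ = _ := by linear_combination hu
  exact mul_left_cancel₀ (thetaProd_ne_zero hτ) this

/-- The second-order relation `(log θ₁)'' = -π²ϑ₃²ϑ₄² (θ₂/θ₁)² - 4(η + π²/12 (ϑ₃⁴ + ϑ₄⁴))`. -/
lemma second_order {τ : ℂ} (hτ : 0 < τ.im) (z : ℂ) :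
    deriv (fun w => dtheta1 w τ) z * theta1 z τ - dtheta1 z τ ^ 2
      = -(Real.pi ^ 2 * theta3 0 τ ^ 2 * theta4 0 τ ^ 2 * theta2 z τ ^ 2)
        - 4 * (etaW τ + Real.pi ^ 2 / 12 * (theta3 0 τ ^ 4 + theta4 0 τ ^ 4)) * theta1 z τ ^ 2 := by
  have hpi : (Real.pi : ℂ) ≠ 0 := by exact_mod_cast Real.pi_ne_zero
  have h2 := theta2_ne_zero hτ
  have h3 := theta3_ne_zero hτ
  have h4 := theta4_ne_zero hτ
  have hτ2 := two_mul_im_pos hτ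
  have hp := theta3_ne_zero hτ2
  have hq := theta2_ne_zero hτ2
  have dq := hasDerivAt_theta2_two_tau hτ
  have dp := hasDerivAt_theta3_two_tau hτ
  have d2 := (hasDerivAt_theta2_tau_heat 0 hτ).differentiableAt.hasDerivAt
  have d3 := (hasDerivAt_theta3_tau 0 hτ).differentiableAt.hasDerivAt
  have d4 := (hasDerivAt_theta4_zero_tau hτ).differentiableAt.hasDerivAt
  have hs := theta_log_deriv_sum hτ
  have hz := second_order_double hτ z
  have h0 := second_order_double hτ 0
  rw [theta1_zero, dtheta1_zero hτ, thetaProd, mul_zero, mul_zero] at h0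
  have s1 := theta1_sq hτ z
  have s2 := theta2_sq hτ z
  have c2 := theta2_zero_sq hτ
  have c3 := theta3_zero_sq hτ
  have c4 := theta4_zero_sq hτ
  -- The duplication formulas for `ϑ_k²` are differentiated in `τ`, and the heat equation turns the
  -- derivatives at `2τ` into second `z`-derivatives. The quotients below, `B2`, `B3`, `B4`, are
  -- `4πi` times the logarithmic derivatives of the theta constants.
  have e2 : 4 * Real.pi * I * deriv (fun t => theta2 0 t) τ / theta2 0 τ * theta2 0 τ ^ 2
      = 2 * (deriv (fun w => dtheta2 w (2 * τ)) 0 * theta3 0 (2 * τ) + deriv (fun w => dtheta3 w (2 * τ)) 0 * theta2 0 (2 * τ)) := by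
    have hl := d2.fun_pow 2
    have hr := (dq.fun_mul dp).const_mul 2
    have he : (fun t => theta2 0 t ^ 2) =ᶠ[𝓝 τ] fun t => 2 * (theta2 0 (2 * t) * theta3 0 (2 * t)) := by
      filter_upwards [eventually_im_pos hτ] with t ht using theta2_zero_sq ht
    have hu := hl.unique (hr.congr_of_eventuallyEq he)
    simp only [Nat.cast_ofNat, Nat.add_one_sub_one, pow_one] at hu
    field_simp at hu ⊢
    linear_combination hu
  have e3 : 4 * Real.pi * I * deriv (fun t => theta3 0 t) τ / theta3 0 τ * theta3 0 τ ^ 2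
      = 2 * (deriv (fun w => dtheta3 w (2 * τ)) 0 * theta3 0 (2 * τ) + deriv (fun w => dtheta2 w (2 * τ)) 0 * theta2 0 (2 * τ)) := by
    have hl := d3.fun_pow 2
    have hr := (dp.fun_pow 2).fun_add (dq.fun_pow 2)
    have he : (fun t => theta3 0 t ^ 2) =ᶠ[𝓝 τ] fun t => theta3 0 (2 * t) ^ 2 + theta2 0 (2 * t) ^ 2 := by
      filter_upwards [eventually_im_pos hτ] with t ht using theta3_zero_sq ht
    have hu := hl.unique (hr.congr_of_eventuallyEq he)
    simp only [Nat.cast_ofNat, Nat.add_one_sub_one, pow_one] at hu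
    field_simp at hu ⊢
    linear_combination hu
  have e4 : 4 * Real.pi * I * deriv (fun t => theta4 0 t) τ / theta4 0 τ * theta4 0 τ ^ 2
      = 2 * (deriv (fun w => dtheta3 w (2 * τ)) 0 * theta3 0 (2 * τ) - deriv (fun w => dtheta2 w (2 * τ)) 0 * theta2 0 (2 * τ)) := by
    have hl := d4.fun_pow 2
    have hr := (dp.fun_pow 2).fun_sub (dq.fun_pow 2)
    have he : (fun t => theta4 0 t ^ 2) =ᶠ[𝓝 τ] fun t => theta3 0 (2 * t) ^ 2 - theta2 0 (2 * t) ^ 2 := by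
      filter_upwards [eventually_im_pos hτ] with t ht using theta4_zero_sq ht
    have hu := hl.unique (hr.congr_of_eventuallyEq he)
    simp only [Nat.cast_ofNat, Nat.add_one_sub_one, pow_one] at hu
    field_simp at hu ⊢
    linear_combination hu
  have hs' : 4 * Real.pi * I * deriv (fun t => theta2 0 t) τ / theta2 0 τ
      + 4 * Real.pi * I * deriv (fun t => theta3 0 t) τ / theta3 0 τ
      + 4 * Real.pi * I * deriv (fun t => theta4 0 t) τ / theta4 0 τ = -(12 * etaW τ) := by
    have e : (4 * Real.pi * I) * (3 * (I / Real.pi * etaW τ)) = -(12 * etaW τ) := by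
      field_simp
      linear_combination 12 * etaW τ * I_sq
    rw [← e, ← hs]
    ring
  generalize 4 * Real.pi * I * deriv (fun t => theta2 0 t) τ / theta2 0 τ = B2 at e2 hs'
  generalize 4 * Real.pi * I * deriv (fun t => theta3 0 t) τ / theta3 0 τ = B3 at e3 hs'
  generalize 4 * Real.pi * I * deriv (fun t => theta4 0 t) τ / theta4 0 τ = B4 at e4 hs'
  rw [hz]
  clear hz hs dq dp d2 d3 d4
  generalize deriv (fun w => dtheta2 w (2 * τ)) 0 = a at *
  generalize deriv (fun w => dtheta3 w (2 * τ)) 0 = b at *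
  generalize theta3 0 (2 * τ) = p at *
  generalize theta2 0 (2 * τ) = q at *
  generalize theta3 (2 * z) (2 * τ) = X at *
  generalize theta2 (2 * z) (2 * τ) = Y at *
  generalize theta2 0 τ = v2 at *
  generalize theta3 0 τ = v3 at *
  generalize theta4 0 τ = v4 at *
  -- The case `z = 0` of the doubled relation gives `ap - bq`, and `e2` gives `ap + bq`; together
  -- they determine `a` and `b` in terms of `B2`.
  have ha : 2 * a = q * (B2 - Real.pi ^ 2 * v3 ^ 2 * v4 ^ 2) := by
    refine mul_left_cancel₀ (mul_ne_zero two_ne_zero hp) ?_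
    linear_combination -h0 - e2 + (B2 - Real.pi ^ 2 * v3 ^ 2 * v4 ^ 2) * c2
  have hb : 2 * b = p * (B2 + Real.pi ^ 2 * v3 ^ 2 * v4 ^ 2) := by
    refine mul_left_cancel₀ (mul_ne_zero two_ne_zero hq) ?_
    linear_combination h0 - e2 + (B2 + Real.pi ^ 2 * v3 ^ 2 * v4 ^ 2) * c2
  -- The differences `B3 - B2`, `B4 - B2` are now explicit, and the sum of the three is `-12η`; this
  -- fixes `B2`.
  have h3' : B3 = B2 + Real.pi ^ 2 * v4 ^ 4 := by
    refine mul_right_cancel₀ (pow_ne_zero 2 h3) ?_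
    linear_combination e3 + p * hb + q * ha - B2 * c3 - Real.pi ^ 2 * v3 ^ 2 * v4 ^ 2 * c4
  have h4' : B4 = B2 + Real.pi ^ 2 * v3 ^ 4 := by
    refine mul_right_cancel₀ (pow_ne_zero 2 h4) ?_
    linear_combination e4 + p * hb - q * ha - B2 * c4 - Real.pi ^ 2 * v3 ^ 2 * v4 ^ 2 * c3
  have hB : B2 = -(4 * (etaW τ + Real.pi ^ 2 / 12 * (v3 ^ 4 + v4 ^ 4))) := by
    rw [h3', h4'] at hs'
    linear_combination hs' / 3
  rw [← neg_eq_iff_eq_neg] at hB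
  rw [← hB]
  linear_combination X * ha - Y * hb - B2 * s1 + Real.pi ^ 2 * v3 ^ 2 * v4 ^ 2 * s2

/-! ### Surjectivity of the modular lambda function -/

/-- The elliptic modular function `λ = ϑ₂⁴/ϑ₃⁴`. -/
def modLambda (τ : ℂ) : ℂ := theta2 0 τ ^ 4 / theta3 0 τ ^ 4

lemma sqrtFactor_pow_four_ne_zero {τ : ℂ} (hτ : 0 < τ.im) : sqrtFactor τ ^ 4 ≠ 0 :=
  pow_ne_zero 4 (sqrtFactor_ne_zero hτ)

lemma one_sub_modLambda {τ : ℂ} (hτ : 0 < τ.im) :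
    1 - modLambda τ = theta4 0 τ ^ 4 / theta3 0 τ ^ 4 := by
  have h3 := theta3_ne_zero hτ
  rw [modLambda]
  field_simp
  linear_combination theta_zero_pow_four hτ

lemma modLambda_ne_zero {τ : ℂ} (hτ : 0 < τ.im) : modLambda τ ≠ 0 :=
  div_ne_zero (pow_ne_zero 4 (theta2_ne_zero hτ)) (pow_ne_zero 4 (theta3_ne_zero hτ))

lemma one_sub_modLambda_ne_zero {τ : ℂ} (hτ : 0 < τ.im) : 1 - modLambda τ ≠ 0 := by
  rw [one_sub_modLambda hτ]
  exact div_ne_zero (pow_ne_zero 4 (theta4_ne_zero hτ)) (pow_ne_zero 4 (theta3_ne_zero hτ))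

lemma modLambda_neg_one_div {τ : ℂ} (hτ : 0 < τ.im) : modLambda (-1 / τ) = 1 - modLambda τ := by
  rw [one_sub_modLambda hτ, modLambda, theta2_zero_neg_one_div hτ, theta3_zero_neg_one_div hτ,
    mul_pow, mul_pow, mul_div_mul_left _ _ (sqrtFactor_pow_four_ne_zero hτ)]

lemma modLambda_add_one {τ : ℂ} (hτ : 0 < τ.im) :
    modLambda (τ + 1) = -(modLambda τ / (1 - modLambda τ)) := by
  have h3 := theta3_ne_zero hτ
  have h4 := theta4_ne_zero hτ
  rw [one_sub_modLambda hτ, modLambda, modLambda, theta2_zero_tau_add_one, theta3_tau_add_one,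
    mul_pow, ← Complex.exp_nat_mul,
    show ((4 : ℕ) * (Real.pi * I / 4) : ℂ) = Real.pi * I by push_cast; ring, Complex.exp_pi_mul_I]
  field_simp

/-- The rational function of degree six invariant under the anharmonic group. -/
def anharm (x : ℂ) : ℂ := (x ^ 2 - x + 1) ^ 3 / (x ^ 2 * (1 - x) ^ 2)

lemma anharm_one_sub (x : ℂ) : anharm (1 - x) = anharm x := by
  simp only [anharm]
  congr 1 <;> ring

lemma anharm_neg_div {x : ℂ} (h0 : x ≠ 0) (h1 : 1 - x ≠ 0) :
    anharm (-(x / (1 - x))) = anharm x := by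
  have h2 : 1 - -(x / (1 - x)) = 1 / (1 - x) := by field_simp; ring
  rw [anharm, h2, anharm]
  field_simp
  ring

/-- The elliptic modular invariant, up to a factor. -/
def modJ (τ : ℂ) : ℂ := anharm (modLambda τ)

lemma modJ_neg_one_div {τ : ℂ} (hτ : 0 < τ.im) : modJ (-1 / τ) = modJ τ := by
  rw [modJ, modLambda_neg_one_div hτ, anharm_one_sub, modJ]

lemma modJ_add_one {τ : ℂ} (hτ : 0 < τ.im) : modJ (τ + 1) = modJ τ := by
  rw [modJ, modLambda_add_one hτ, anharm_neg_div (modLambda_ne_zero hτ)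
    (one_sub_modLambda_ne_zero hτ), modJ]

open UpperHalfPlane ModularForm MatrixGroups in
lemma modJ_smul (γ : SL(2, ℤ)) (z : ℍ) : modJ (γ • z : ℍ) = modJ z := by
  have h : (fun τ : ℍ => modJ τ) ∣[(0 : ℤ)] γ = fun τ : ℍ => modJ τ := by
    refine SlashInvariantForm.slash_action_generators_SL2Z ?_ ?_ γ
    · ext z
      rw [SL_slash_apply, UpperHalfPlane.modular_S_smul]
      have := modJ_neg_one_div z.2
      rw [neg_div, one_div] at this
      simpa using this
    · ext z
      rw [SL_slash_apply, UpperHalfPlane.modular_T_smul]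
      simpa [add_comm] using modJ_add_one z.2
  have := congrFun h z
  rw [SL_slash_apply] at this
  simpa using this

lemma tendsto_modLambda : Tendsto modLambda imTop (𝓝 0) := by
  have h2 := ((tendsto_theta3_half_imTop 0).pow 4).mul (tendsto_exp_imTop one_pos)
  have h := h2.div ((tendsto_theta3_imTop 0).pow 4) (by norm_num)
  rw [mul_zero, zero_div] at h
  refine h.congr fun τ => ?_
  rw [modLambda, theta2_zero_eq, mul_pow, ← Complex.exp_nat_mul,
    show ((4 : ℕ) * (Real.pi * I * τ / 4) : ℂ) = Real.pi * I * (1 : ℝ) * τ by push_cast; ring]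
  simp [mul_comm]

/-- `λ → 0` at `i∞`, and `anharm` has a pole at `0`. -/
lemma eventually_lt_norm_modJ (M : ℝ) : ∀ᶠ τ in imTop, M < ‖modJ τ‖ := by
  have hN : Tendsto (fun τ => ‖modLambda τ ^ 2 - modLambda τ + 1‖ ^ 3) imTop (𝓝 1) := by
    have := ((((tendsto_modLambda.pow 2).sub tendsto_modLambda).add_const 1).norm).pow 3
    simpa using this
  have hD : Tendsto (fun τ => ‖modLambda τ ^ 2 * (1 - modLambda τ) ^ 2‖) imTop (𝓝 0) := by
    have := ((tendsto_modLambda.pow 2).mul ((tendsto_modLambda.const_sub 1).pow 2)).norm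
    simpa using this
  have hM : (0 : ℝ) < 1 / (2 * (|M| + 1)) := by positivity
  filter_upwards [hN.eventually (lt_mem_nhds (show (1 / 2 : ℝ) < 1 by norm_num)),
    hD.eventually (gt_mem_nhds hM), eventually_imTop 1] with τ h1 h2 h3
  have hτ : 0 < τ.im := by linarith
  have hd : 0 < ‖modLambda τ ^ 2 * (1 - modLambda τ) ^ 2‖ := norm_pos_iff.2
    (mul_ne_zero (pow_ne_zero 2 (modLambda_ne_zero hτ)) (pow_ne_zero 2 (one_sub_modLambda_ne_zero hτ)))
  rw [modJ, anharm, norm_div, norm_pow, lt_div_iff₀ hd]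
  have h4 : |M| * ‖modLambda τ ^ 2 * (1 - modLambda τ) ^ 2‖ ≤ 1 / 2 := by
    have h5 := (lt_div_iff₀ (show 0 < 2 * (|M| + 1) by positivity)).1 h2
    nlinarith
  have h6 := mul_le_mul_of_nonneg_right (le_abs_self M) hd.le
  linarith

lemma differentiableAt_modLambda {τ : ℂ} (hτ : 0 < τ.im) : DifferentiableAt ℂ modLambda τ :=
  ((hasDerivAt_theta2_tau_heat 0 hτ).differentiableAt.pow 4).div
    ((hasDerivAt_theta3_tau 0 hτ).differentiableAt.pow 4) (pow_ne_zero 4 (theta3_ne_zero hτ))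

lemma differentiableAt_modJ {τ : ℂ} (hτ : 0 < τ.im) : DifferentiableAt ℂ modJ τ := by
  have h := differentiableAt_modLambda hτ
  have h0 := modLambda_ne_zero hτ
  have h1 := one_sub_modLambda_ne_zero hτ
  unfold modJ anharm
  exact DifferentiableAt.fun_div (by fun_prop) (by fun_prop)
    (mul_ne_zero (pow_ne_zero 2 h0) (pow_ne_zero 2 h1))

lemma imTop_neBot : imTop.NeBot := by
  refine comap_neBot fun s hs => ?_
  obtain ⟨y, hy⟩ := (mem_atTop_sets.1 hs)
  exact ⟨y * I, by simpa using hy y le_rfl⟩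

/-- The open mapping theorem; constancy is excluded by the growth at `i∞`. -/
lemma isOpen_image_modJ : IsOpen (modJ '' {τ : ℂ | 0 < τ.im}) := by
  have hU : IsOpen {τ : ℂ | 0 < τ.im} := isOpen_lt continuous_const continuous_im
  have hA : AnalyticOnNhd ℂ modJ {τ : ℂ | 0 < τ.im} :=
    DifferentiableOn.analyticOnNhd (fun τ hτ => (differentiableAt_modJ hτ).differentiableWithinAt) hU
  rcases hA.is_constant_or_isOpen (convex_halfSpace_im_gt 0).isPreconnected with ⟨w, hw⟩ | h
  · have := imTop_neBot
    obtain ⟨τ, h1, h2⟩ := ((eventually_lt_norm_modJ ‖w‖).and (eventually_imTop 1)).exists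
    rw [hw τ (show 0 < τ.im by linarith)] at h1
    exact absurd h1 (lt_irrefl _)
  · exact h _ subset_rfl hU

lemma exists_mem_fd_modJ_eq {τ : ℂ} (hτ : 0 < τ.im) :
    ∃ z : UpperHalfPlane, z ∈ ModularGroup.fd ∧ modJ z = modJ τ := by
  obtain ⟨g, hg⟩ := ModularGroup.exists_smul_mem_fd (UpperHalfPlane.mk τ hτ)
  exact ⟨_, hg, modJ_smul g _⟩

/-- A convergent sequence of values is bounded, so its preimages, moved into the fundamental domain,
stay below some height `Y`. They lie in a compact set, whose image is closed. Together with openness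
this gives surjectivity onto the connected plane. -/
lemma isClosed_image_modJ : IsClosed (modJ '' {τ : ℂ | 0 < τ.im}) := by
  rw [← isSeqClosed_iff_isClosed]
  intro u w hu hw
  obtain ⟨M, hM⟩ := (hw.norm.isBoundedUnder_le)
  rw [eventually_map] at hM
  obtain ⟨Y, hY⟩ := (mem_atTop_sets.1 (mem_comap.1 (eventually_lt_norm_modJ M)).choose_spec.1)
  have hY' : ∀ τ : ℂ, Y ≤ τ.im → M < ‖modJ τ‖ := fun τ hτ =>
    (mem_comap.1 (eventually_lt_norm_modJ M)).choose_spec.2 (hY _ hτ)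
  have hc : IsClosed ((fun z : UpperHalfPlane => modJ z) ''
      ModularGroup.truncatedFundamentalDomain Y) := by
    refine ((ModularGroup.isCompact_truncatedFundamentalDomain Y).image_of_continuousOn ?_).isClosed
    intro z _
    exact ((differentiableAt_modJ z.2).continuousAt.comp
      UpperHalfPlane.continuous_coe.continuousAt).continuousWithinAt
  have hmem : ∀ᶠ n in atTop, u n ∈ (fun z : UpperHalfPlane => modJ z) ''
      ModularGroup.truncatedFundamentalDomain Y := by
    filter_upwards [hM] with n hn
    obtain ⟨τ, hτ, he⟩ := hu n
    obtain ⟨z, hz, hJ⟩ := exists_mem_fd_modJ_eq hτ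
    refine ⟨z, ⟨hz, ?_⟩, hJ.trans he⟩
    by_contra hlt
    have h1 := hY' z (le_of_lt (not_le.1 hlt))
    rw [hJ, he] at h1
    exact absurd hn (not_le.2 h1)
  obtain ⟨z, _, hz⟩ := hc.mem_of_tendsto hw hmem
  exact ⟨z, z.2, hz⟩

lemma modJ_surjective (w : ℂ) : ∃ τ : ℂ, 0 < τ.im ∧ modJ τ = w := by
  have h : modJ '' {τ : ℂ | 0 < τ.im} = Set.univ :=
    IsClopen.eq_univ ⟨isClosed_image_modJ, isOpen_image_modJ⟩ ⟨modJ I, I, im_I_pos, rfl⟩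
  exact (h ▸ Set.mem_univ w : w ∈ modJ '' {τ : ℂ | 0 < τ.im})

/-- After clearing denominators the difference splits into six factors linear in `y`, one for each
element of the anharmonic group. -/
lemma anharm_eq_anharm {x y : ℂ} (hx : x ≠ 0) (hx1 : 1 - x ≠ 0) (hy : y ≠ 0) (hy1 : 1 - y ≠ 0)
    (h : anharm x = anharm y) : y = x ∨ y = 1 - x ∨ x * y = 1 ∨ (1 - x) * y = 1 ∨
      (1 - x) * y = -x ∨ x * y = -(1 - x) := by
  rw [anharm, anharm, div_eq_div_iff (mul_ne_zero (pow_ne_zero 2 hx) (pow_ne_zero 2 hx1))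
    (mul_ne_zero (pow_ne_zero 2 hy) (pow_ne_zero 2 hy1))] at h
  have : (y - x) * ((y - (1 - x)) * ((x * y - 1) * (((1 - x) * y - 1) * (((1 - x) * y + x)
      * (x * y + (1 - x)))))) = 0 := by
    linear_combination (-1 : ℂ) * h
  simp only [mul_eq_zero] at this
  rcases this with h | h | h | h | h | h
  · exact Or.inl (by linear_combination h)
  · exact Or.inr (Or.inl (by linear_combination h))
  · exact Or.inr (Or.inr (Or.inl (by linear_combination h)))
  · exact Or.inr (Or.inr (Or.inr (Or.inl (by linear_combination h))))
  · exact Or.inr (Or.inr (Or.inr (Or.inr (Or.inl (by linear_combination h)))))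
  · exact Or.inr (Or.inr (Or.inr (Or.inr (Or.inr (by linear_combination h)))))

/-- Some `λ(τ)` has the same invariant as `w`, hence lies in its anharmonic orbit. The substitutions
`τ ↦ -1/τ` and `τ ↦ τ + 1` act on `λ` by generators of that group, so `w` is itself a value. -/
lemma modLambda_surjective {w : ℂ} (h0 : w ≠ 0) (h1 : w ≠ 1) :
    ∃ τ : ℂ, 0 < τ.im ∧ modLambda τ = w := by
  obtain ⟨τ, hτ, h⟩ := modJ_surjective (anharm w)
  have hl := modLambda_ne_zero hτ
  have hl1 := one_sub_modLambda_ne_zero hτ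
  have hS : ∀ x : ℂ, (∃ τ : ℂ, 0 < τ.im ∧ modLambda τ = x) →
      ∃ τ : ℂ, 0 < τ.im ∧ modLambda τ = 1 - x := by
    rintro _ ⟨t, ht, rfl⟩
    exact ⟨-1 / t, neg_one_div_im_pos ht, modLambda_neg_one_div ht⟩
  have hT : ∀ x : ℂ, (∃ τ : ℂ, 0 < τ.im ∧ modLambda τ = x) →
      ∃ τ : ℂ, 0 < τ.im ∧ modLambda τ = -(x / (1 - x)) := by
    rintro _ ⟨t, ht, rfl⟩
    exact ⟨t + 1, by simpa using ht, modLambda_add_one ht⟩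
  have hx : ∃ t : ℂ, 0 < t.im ∧ modLambda t = modLambda τ := ⟨τ, hτ, rfl⟩
  rcases anharm_eq_anharm hl hl1 h0 (sub_ne_zero.2 (Ne.symm h1)) h with h | h | h | h | h | h
  · exact h ▸ hx
  · exact h ▸ hS _ hx
  · obtain ⟨t, ht, e⟩ := hS _ (hT _ (hS _ hx))
    refine ⟨t, ht, e.trans ?_⟩
    rw [sub_sub_cancel]
    field_simp
    linear_combination -h
  · obtain ⟨t, ht, e⟩ := hS _ (hT _ hx)
    refine ⟨t, ht, e.trans ?_⟩
    field_simp
    linear_combination -h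
  · obtain ⟨t, ht, e⟩ := hT _ hx
    refine ⟨t, ht, e.trans ?_⟩
    field_simp
    linear_combination -h
  · obtain ⟨t, ht, e⟩ := hT _ (hS _ hx)
    refine ⟨t, ht, e.trans ?_⟩
    rw [sub_sub_cancel]
    field_simp
    linear_combination -h

/-! ### Zeros of theta functions -/

/-- At a common zero both `θ₃(2u|2τ)` and `θ₂(2u|2τ)` vanish. The product formula then makes `θ₁(y)
θ₁(2u - y)` vanish identically, against `θ₁'(0) ≠ 0`. -/
lemma theta1_theta2_no_common_zero {τ : ℂ} (hτ : 0 < τ.im) {u : ℂ} (h1 : theta1 u τ = 0) :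
    theta2 u τ ≠ 0 := by
  intro h2
  have hτ2 := two_mul_im_pos hτ
  have s1 := theta1_sq hτ u
  have s2 := theta2_sq hτ u
  rw [h1] at s1
  rw [h2] at s2
  have hX : theta3 (2 * u) (2 * τ) = 0 := by
    refine mul_right_cancel₀ (theta2_ne_zero hτ2) ?_
    linear_combination -(s1 + s2) / 2
  have hY : theta2 (2 * u) (2 * τ) = 0 := by
    refine mul_right_cancel₀ (theta3_ne_zero hτ2) ?_
    linear_combination (s1 - s2) / 2
  have hd := differentiable_theta1 hτ
  have key : ∀ y, theta1 y τ * theta1 (2 * u - y) τ = 0 := by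
    intro y
    rw [theta1_mul_theta1 _ _ hτ, show y + (2 * u - y) = 2 * u by ring, hX, hY]
    ring
  obtain ⟨a, ha⟩ : ∃ a, theta1 a τ ≠ 0 := by
    by_contra hcon
    push Not at hcon
    apply dtheta1_zero_ne_zero hτ
    rw [dtheta1, show (fun w => theta1 w τ) = fun _ => 0 from funext hcon]
    simp
  refine ha (eq_zero_of_mul_eq_zero (g := fun y => theta1 (2 * u - y) τ) (a := 2 * u - a) hd
    (hd.comp (differentiable_id.const_sub _)) key ?_ a)
  simpa using ha

lemma bounded_of_doubly_periodic {f : ℂ → ℂ} (hf : Continuous f) {τ : ℂ} (hτ : 0 < τ.im)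
    (h1 : ∀ u, f (u + 1) = f u) (h2 : ∀ u, f (u + τ) = f u) : Bornology.IsBounded (Set.range f) := by
  have hg : Continuous fun p : ℝ × ℝ => f (p.1 + p.2 * τ) := by fun_prop
  have hK : IsCompact (Set.Icc (0 : ℝ) 1 ×ˢ Set.Icc (0 : ℝ) 1) := isCompact_Icc.prod isCompact_Icc
  refine (hK.image hg).isBounded.subset ?_
  rintro _ ⟨u, rfl⟩
  have p1 : Function.Periodic f 1 := h1
  have p2 : Function.Periodic f τ := h2
  set b := u.im / τ.im
  set a := u.re - b * τ.re
  have hu : u = a + b * τ := by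
    apply Complex.ext
    · simp [a]
    · simp [b, hτ.ne']
  refine ⟨(Int.fract a, Int.fract b), ⟨⟨Int.fract_nonneg _, (Int.fract_lt_one _).le⟩,
    ⟨Int.fract_nonneg _, (Int.fract_lt_one _).le⟩⟩, ?_⟩
  have e : ((Int.fract a : ℝ) : ℂ) + ((Int.fract b : ℝ) : ℂ) * τ = u - ⌊b⌋ * τ - ⌊a⌋ * 1 := by
    rw [hu, ← Int.self_sub_floor, ← Int.self_sub_floor]
    push_cast
    ring
  simp only
  rw [e, p1.sub_int_mul_eq, p2.sub_int_mul_eq]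

/-- An entire function with the quasi-periodicity of a theta function of order two has a zero. -/
lemma exists_zero_of_quasi_periodic {F : ℂ → ℂ} (hF : Differentiable ℂ F) {τ : ℂ} (hτ : 0 < τ.im)
    (h1 : ∀ u, F (u + 1) = F u)
    (h2 : ∀ u, F (u + τ) = cexp (-(2 * Real.pi * I * (τ + 2 * u))) * F u) : ∃ u, F u = 0 := by
  by_contra hcon
  push Not at hcon
  have hF' : Differentiable ℂ (deriv F) := (hF.contDiff (n := 2)).differentiable_deriv_two
  have d1 : ∀ u, deriv F (u + 1) = deriv F u := by
    intro u
    have h := (hF (u + 1)).hasDerivAt.comp_add_const u 1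
    rw [funext h1] at h
    exact h.deriv.symm
  have d2 : ∀ u, deriv F (u + τ) = cexp (-(2 * Real.pi * I * (τ + 2 * u)))
      * (deriv F u - 4 * Real.pi * I * F u) := by
    intro u
    have h := (hF (u + τ)).hasDerivAt.comp_add_const u τ
    rw [funext h2] at h
    have he : HasDerivAt (fun u => cexp (-(2 * Real.pi * I * (τ + 2 * u))))
        (cexp (-(2 * Real.pi * I * (τ + 2 * u))) * (-(2 * Real.pi * I * 2))) u := by
      have := ((((hasDerivAt_id u).const_mul 2).const_add τ).const_mul (2 * Real.pi * I)).fun_neg.cexp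
      simpa using this
    rw [h.unique (he.fun_mul (hF u).hasDerivAt)]
    ring
  set h : ℂ → ℂ := fun u => deriv F u / F u with hdef
  -- Without zeros the logarithmic derivative `h` is entire, and `h'` is doubly periodic, so
  -- constant by Liouville. Thus `h` is affine; period `1` makes its slope zero, which contradicts
  -- the increment `-4πi` along `τ`.
  have hh : Differentiable ℂ h := fun u => (hF' u).div (hF u) (hcon u)
  have e1 : ∀ u, h (u + 1) = h u := fun u => by simp only [hdef, d1, h1]
  have e2 : ∀ u, h (u + τ) = h u - 4 * Real.pi * I := by
    intro u
    simp only [hdef, d2, h2]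
    rw [mul_div_mul_left _ _ (Complex.exp_ne_zero _), sub_div, mul_div_cancel_right₀ _ (hcon u)]
  have hh' : Differentiable ℂ (deriv h) := (hh.contDiff (n := 2)).differentiable_deriv_two
  have p1 : ∀ u, deriv h (u + 1) = deriv h u := by
    intro u
    have := (hh (u + 1)).hasDerivAt.comp_add_const u 1
    rw [funext e1] at this
    exact this.deriv.symm
  have p2 : ∀ u, deriv h (u + τ) = deriv h u := by
    intro u
    have := (hh (u + τ)).hasDerivAt.comp_add_const u τ
    rw [funext e2] at this
    exact this.unique ((hh u).hasDerivAt.sub_const _)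
  obtain ⟨c, hc⟩ := hh'.exists_const_forall_eq_of_bounded
    (bounded_of_doubly_periodic hh'.continuous hτ p1 p2)
  have hlin : ∀ u v, h u - c * u = h v - c * v := by
    refine is_const_of_deriv_eq_zero (f := fun u => h u - c * u) (by fun_prop) fun u => ?_
    have := (hh u).hasDerivAt.fun_sub ((hasDerivAt_id u).const_mul c)
    simp only [id, mul_one, hc, sub_self] at this
    exact this.deriv
  have l1 := hlin (0 + 1) 0
  have l2 := hlin (0 + τ) 0
  rw [e1] at l1
  rw [e2] at l2
  have hc0 : c = 0 := by linear_combination -l1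
  rw [hc0] at l2
  have : (4 * Real.pi * I : ℂ) = 0 := by linear_combination -l2
  simp [Real.pi_ne_zero] at this

lemma exists_theta2_sq_eq {τ : ℂ} (hτ : 0 < τ.im) {x : ℂ} (hx : x ≠ 0) (y : ℂ) :
    ∃ u, theta1 u τ ≠ 0 ∧ x * theta2 u τ ^ 2 = y * theta1 u τ ^ 2 := by
  have d1 := differentiable_theta1 hτ
  have d2 := differentiable_theta2 hτ
  obtain ⟨u, hu⟩ := exists_zero_of_quasi_periodic
    (F := fun u => x * theta2 u τ ^ 2 - y * theta1 u τ ^ 2) (by fun_prop) hτ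
    (fun u => by simp only [theta1_add_one, theta2_add_one]; ring)
    (fun u => by
      have : cexp (-(2 * Real.pi * I * (τ + 2 * u))) = cexp (-Real.pi * I * (τ + 2 * u)) ^ 2 := by
        rw [← Complex.exp_nat_mul]
        congr 1
        push_cast
        ring
      simp only [theta1_add_tau, theta2_add_tau, this]
      ring)
  refine ⟨u, fun h1 => ?_, by linear_combination hu⟩
  simp only [h1] at hu
  have : x * theta2 u τ ^ 2 = 0 := by linear_combination hu
  exact mul_ne_zero hx (pow_ne_zero 2 (theta1_theta2_no_common_zero hτ h1)) this

/-! ### Uniqueness of solutions -/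

/-- Restriction to the segment from `z₀` to `z` reduces the complex equation to a real one, with
field `(z - z₀) • v` on `[0, 1]`, to which Grönwall uniqueness applies. -/
lemma eventuallyEq_of_autonomous_ode {E : Type*} [NormedAddCommGroup E] [NormedSpace ℂ E]
    [NormedSpace ℝ E] [IsScalarTower ℝ ℂ E] {v : E → E} {f g : ℂ → E} {z₀ : ℂ}
    (hv : ContDiffAt ℂ 1 v (f z₀)) (hf : ∀ᶠ z in 𝓝 z₀, HasDerivAt f (v (f z)) z)
    (hg : ∀ᶠ z in 𝓝 z₀, HasDerivAt g (v (g z)) z) (h : f z₀ = g z₀) : f =ᶠ[𝓝 z₀] g := by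
  obtain ⟨K, s, hs, hK⟩ := hv.exists_lipschitzOnWith
  have cf : ∀ᶠ z in 𝓝 z₀, f z ∈ s := hf.self_of_nhds.continuousAt.eventually_mem hs
  have cg : ∀ᶠ z in 𝓝 z₀, g z ∈ s := hg.self_of_nhds.continuousAt.eventually_mem (h ▸ hs)
  obtain ⟨r, hr, hall⟩ := Metric.eventually_nhds_iff_ball.1 ((hf.and cf).and (hg.and cg))
  refine Metric.eventually_nhds_iff_ball.2 ⟨r, hr, fun z hz => ?_⟩
  set c : ℝ → ℂ := fun t => z₀ + t * (z - z₀) with hc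
  have hcd : ∀ t, HasDerivAt c (z - z₀) t := by
    intro t
    have h1 : HasDerivAt (fun t : ℝ => (t : ℂ) * (z - z₀)) (z - z₀) t := by
      simpa using (hasDerivAt_id t).ofReal_comp.mul_const (z - z₀)
    exact h1.const_add z₀
  have hmem : ∀ t ∈ Set.Icc (0 : ℝ) 1, c t ∈ Metric.ball z₀ r := by
    intro t ht
    rw [Metric.mem_ball, dist_eq_norm] at hz ⊢
    simp only [hc, add_sub_cancel_left, norm_mul, Complex.norm_real, Real.norm_eq_abs,
      abs_of_nonneg ht.1]
    exact lt_of_le_of_lt (mul_le_of_le_one_left (norm_nonneg _) ht.2) hz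
  have df : ∀ t ∈ Set.Icc (0 : ℝ) 1, HasDerivAt (f ∘ c) ((z - z₀) • v (f (c t))) t := fun t ht =>
    (hall _ (hmem t ht)).1.1.scomp t (hcd t)
  have dg : ∀ t ∈ Set.Icc (0 : ℝ) 1, HasDerivAt (g ∘ c) ((z - z₀) • v (g (c t))) t := fun t ht =>
    (hall _ (hmem t ht)).2.1.scomp t (hcd t)
  have key := ODE_solution_unique_of_mem_Icc_right (a := 0) (b := 1) (f := f ∘ c) (g := g ∘ c)
    (v := fun _ x => (z - z₀) • v x) (s := fun _ => s) (K := ‖z - z₀‖₊ * K)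
    (fun t _ => (lipschitzWith_smul (z - z₀)).comp_lipschitzOnWith hK)
    (fun t ht => (df t ht).continuousAt.continuousWithinAt)
    (fun t ht => (df t (Set.Ico_subset_Icc_self ht)).hasDerivWithinAt)
    (fun t ht => (hall _ (hmem t (Set.Ico_subset_Icc_self ht))).1.2)
    (fun t ht => (dg t ht).continuousAt.continuousWithinAt)
    (fun t ht => (dg t (Set.Ico_subset_Icc_self ht)).hasDerivWithinAt)
    (fun t ht => (hall _ (hmem t (Set.Ico_subset_Icc_self ht))).2.2)
    (by simp [hc, h])
  have := key (Set.right_mem_Icc.2 zero_le_one)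
  simpa [hc] using this

/-- The values of the unknown functions as a vector. -/
def Values.vec (V : Values) : ℂ × ℂ × ℂ × ℂ × ℂ := (V.t1, V.t2, V.t3, V.t4, V.d1)

lemma Values.vec_injective : Function.Injective Values.vec := by
  intro V W h
  simp only [Values.vec, Prod.mk.injEq] at h
  exact Values.ext h.1 h.2.1 h.2.2.1 h.2.2.2.1 h.2.2.2.2

/-- The vector field of the system. -/
def vecField (P : Params) (x : ℂ × ℂ × ℂ × ℂ × ℂ) : ℂ × ℂ × ℂ × ℂ × ℂ :=
  (x.2.2.2.2,
   x.2.2.2.2 / x.1 * x.2.1 - Real.pi * P.v2 ^ 2 * (x.2.2.1 * x.2.2.2.1 / x.1),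
   x.2.2.2.2 / x.1 * x.2.2.1 - Real.pi * P.v3 ^ 2 * (x.2.1 * x.2.2.2.1 / x.1),
   x.2.2.2.2 / x.1 * x.2.2.2.1 - Real.pi * P.v4 ^ 2 * (x.2.1 * x.2.2.1 / x.1),
   x.2.2.2.2 ^ 2 / x.1 - Real.pi ^ 2 * P.v3 ^ 2 * P.v4 ^ 2 * (x.2.1 ^ 2 / x.1) - 4 * P.lam * x.1)

lemma contDiffAt_vecField (P : Params) {x : ℂ × ℂ × ℂ × ℂ × ℂ} (hx : x.1 ≠ 0) :
    ContDiffAt ℂ 1 (vecField P) x := by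
  unfold vecField
  fun_prop (disch := exact hx)

lemma IsSolution.hasDerivAt_vec {P : Params} {U : Set ℂ} {X : ℂ → Values} (h : IsSolution P U X)
    {z : ℂ} (hz : z ∈ U) : HasDerivAt (fun w => (X w).vec) (vecField P (X z).vec) z :=
  (h.eq1 z hz).prodMk ((h.eq2 z hz).prodMk ((h.eq3 z hz).prodMk ((h.eq4 z hz).prodMk (h.eq5 z hz))))

lemma IsSolution.eventuallyEq {P : Params} {U U' : Set ℂ} {X Y : ℂ → Values} {z₀ : ℂ}
    (hX : IsSolution P U X) (hY : IsSolution P U' Y) (hU : U ∈ 𝓝 z₀) (hU' : U' ∈ 𝓝 z₀)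
    (h : X z₀ = Y z₀) : (fun w => (X w).vec) =ᶠ[𝓝 z₀] fun w => (Y w).vec := by
  refine eventuallyEq_of_autonomous_ode (v := vecField P)
    (contDiffAt_vecField P (hX.ne_zero z₀ (mem_of_mem_nhds hU))) ?_ ?_ (by rw [h])
  · filter_upwards [hU] with z hz using hX.hasDerivAt_vec hz
  · filter_upwards [hU'] with z hz using hY.hasDerivAt_vec hz

/-- `Y` is entire, so the identity theorem extends local equality to `U` without first knowing that
`Y` solves the system on all of `U`. -/
lemma IsSolution.eqOn_of_differentiable {P : Params} {U U' : Set ℂ} {X Y : ℂ → Values} {z₀ : ℂ}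
    (hX : IsSolution P U X) (hY : IsSolution P U' Y) (hU : IsOpen U) (hc : IsPreconnected U)
    (hz : z₀ ∈ U) (hU' : U' ∈ 𝓝 z₀) (hd : Differentiable ℂ fun w => (Y w).vec)
    (h : X z₀ = Y z₀) : Set.EqOn X Y U := by
  have hXa : AnalyticOnNhd ℂ (fun w => (X w).vec) U :=
    DifferentiableOn.analyticOnNhd
      (fun w hw => (hX.hasDerivAt_vec hw).differentiableAt.differentiableWithinAt) hU
  have hYa : AnalyticOnNhd ℂ (fun w => (Y w).vec) U := fun w _ => hd.analyticAt w
  have := hXa.eqOn_of_preconnected_of_eventuallyEq hYa hc hz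
    (hX.eventuallyEq hY (hU.mem_nhds hz) hU' h)
  exact fun w hw => Values.vec_injective (this hw)

/-! ### The modular transformations of `η` and a change of the periods -/

lemma etaW_add_one (τ : ℂ) : etaW (τ + 1) = etaW τ := by
  have h : ∀ k : ℕ, cexp (2 * (k + 1) * Real.pi * I * (τ + 1))
      = cexp (2 * (k + 1) * Real.pi * I * τ) := by
    intro k
    rw [show (2 * (k + 1) * Real.pi * I * (τ + 1) : ℂ)
      = 2 * (k + 1) * Real.pi * I * τ + ((k + 1 : ℕ) : ℂ) * (2 * Real.pi * I) by push_cast; ring,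
      Complex.exp_add, Complex.exp_nat_mul_two_pi_mul_I, mul_one]
  simp only [etaW, h]

/-- Differentiation of `η(-1/τ)² = -iτ η(τ)²` for the Dedekind function; squaring removes the branch
of the root, and the factor `τ` produces the anomalous linear term. -/
lemma etaW_neg_one_div {τ : ℂ} (hτ : 0 < τ.im) :
    etaW (-1 / τ) = τ ^ 2 * etaW τ - Real.pi * I / 2 * τ := by
  have hτ0 := ne_zero_of_im_pos hτ
  have hS := neg_one_div_im_pos hτ
  have hη := ModularForm.eta_ne_zero (z := τ) hτ
  have hinv : HasDerivAt (fun t : ℂ => -1 / t) (1 / τ ^ 2) τ := by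
    simpa [div_eq_mul_inv] using (hasDerivAt_inv hτ0).const_mul (-1 : ℂ)
  have hsq : ∀ t : ℂ, 0 < t.im →
      ModularForm.eta (-1 / t) ^ 2 = -I * t * ModularForm.eta t ^ 2 := by
    intro t ht
    rw [eta_neg_one_div ht, mul_pow, sqrtFactor_sq]
  have h1 : HasDerivAt (fun t => ModularForm.eta (-1 / t) ^ 2) _ τ :=
    ((hasDerivAt_eta hS).comp τ hinv).pow 2
  have h2 : HasDerivAt (fun t => -I * t * ModularForm.eta t ^ 2) _ τ :=
    ((hasDerivAt_id τ).const_mul (-I)).mul ((hasDerivAt_eta hτ).pow 2)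
  have hev : (fun t => ModularForm.eta (-1 / t) ^ 2)
      =ᶠ[𝓝 τ] fun t => -I * t * ModularForm.eta t ^ 2 := by
    filter_upwards [(isOpen_lt continuous_const Complex.continuous_im).mem_nhds hτ] with t ht
      using hsq t ht
  have h := h1.unique (h2.congr_of_eventuallyEq hev)
  have hpi : (Real.pi : ℂ) ≠ 0 := by exact_mod_cast Real.pi_ne_zero
  have e := hsq τ hτ
  simp only [Function.comp_apply, id, Nat.cast_ofNat, Nat.add_one_sub_one, pow_one, mul_one] at h
  have h' : 2 * (I / Real.pi * etaW (-1 / τ)) * (1 / τ ^ 2) * ModularForm.eta (-1 / τ) ^ 2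
      = -I * ModularForm.eta τ ^ 2
        + -I * τ * (2 * (I / Real.pi * etaW τ) * ModularForm.eta τ ^ 2) := by
    linear_combination h
  rw [e] at h'
  field_simp at h'
  rw [← neg_div] at h'
  linear_combination (1 / 2 : ℂ) * h' * I + (etaW (-1 / τ) - τ ^ 2 * etaW τ) * I_sq

lemma theta_zero_pow_four_neg_one_div {τ : ℂ} (hτ : 0 < τ.im) :
    theta2 0 (-1 / τ) ^ 4 = -τ ^ 2 * theta4 0 τ ^ 4
      ∧ theta3 0 (-1 / τ) ^ 4 = -τ ^ 2 * theta3 0 τ ^ 4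
      ∧ theta4 0 (-1 / τ) ^ 4 = -τ ^ 2 * theta2 0 τ ^ 4 := by
  have h : sqrtFactor τ ^ 4 = -τ ^ 2 := by
    rw [show sqrtFactor τ ^ 4 = (sqrtFactor τ ^ 2) ^ 2 by ring, sqrtFactor_sq, mul_pow, neg_sq,
      I_sq]
    ring
  rw [theta2_zero_neg_one_div hτ, theta3_zero_neg_one_div hτ, theta4_zero_neg_one_div hτ,
    mul_pow, mul_pow, mul_pow, h]
  exact ⟨rfl, rfl, rfl⟩

lemma theta2_zero_pow_four_add_two (τ : ℂ) : theta2 0 (τ + 2) ^ 4 = theta2 0 τ ^ 4 := by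
  rw [show τ + 2 = τ + 1 + 1 by ring, theta2_zero_tau_add_one, theta2_zero_tau_add_one, ← mul_assoc,
    mul_pow, ← Complex.exp_add, ← Complex.exp_nat_mul,
    show ((4 : ℕ) * (Real.pi * I / 4 + Real.pi * I / 4) : ℂ) = 2 * Real.pi * I by push_cast; ring,
    Complex.exp_two_pi_mul_I, one_mul]

/-- The substitution `τ ↦ τ / (1 - 2τ)` preserves the ratios of the `ϑ_k⁴`, but not the ones with
`η`. -/
lemma exists_congruent_modulus {τ : ℂ} (hτ : 0 < τ.im) :
    ∃ τ' c e : ℂ, 0 < τ'.im ∧ c ≠ 0 ∧ e ≠ 0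
      ∧ theta2 0 τ' ^ 4 = c ^ 2 * theta2 0 τ ^ 4 ∧ theta3 0 τ' ^ 4 = c ^ 2 * theta3 0 τ ^ 4
      ∧ theta4 0 τ' ^ 4 = c ^ 2 * theta4 0 τ ^ 4 ∧ etaW τ' = c ^ 2 * etaW τ + e := by
  have hτ0 := ne_zero_of_im_pos hτ
  have hS := neg_one_div_im_pos hτ
  have hS2 : 0 < (-1 / τ + 2).im := by simpa using hS
  have hne := ne_zero_of_im_pos hS2
  have hpi : (Real.pi : ℂ) ≠ 0 := by exact_mod_cast Real.pi_ne_zero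
  obtain ⟨a2, a3, a4⟩ := theta_zero_pow_four_neg_one_div hS2
  obtain ⟨b2, b3, b4⟩ := theta_zero_pow_four_neg_one_div hτ
  -- The substitution is inversion, shift by `2`, inversion. Here `c = 2τ - 1`, and `e = -πic`
  -- collects the anomalies of the two inversions.
  refine ⟨-1 / (-1 / τ + 2), (-1 / τ + 2) * τ, -(Real.pi * I * τ * (-1 / τ + 2)),
    neg_one_div_im_pos hS2, mul_ne_zero hne hτ0, ?_, ?_, ?_, ?_, ?_⟩
  · simp [hpi, hτ0, hne, I_ne_zero]
  · rw [a2, show -1 / τ + 2 = -1 / τ + 1 + 1 by ring, theta4_tau_add_one, theta3_tau_add_one, b4]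
    ring
  · rw [a3, show -1 / τ + 2 = -1 / τ + 1 + 1 by ring, theta3_tau_add_one, theta4_tau_add_one, b3]
    ring
  · rw [a4, theta2_zero_pow_four_add_two, b2]
    ring
  · rw [etaW_neg_one_div hS2]
    nth_rewrite 2 [show -1 / τ + 2 = -1 / τ + 1 + 1 by ring]
    rw [etaW_add_one, etaW_add_one, etaW_neg_one_div hτ]
    field_simp
    ring

/-! ### Characteristics -/

lemma neg_one_zpow_sq (n : ℤ) : ((-1 : ℂ) ^ n) ^ 2 = 1 := by
  rcases Int.even_or_odd n with h | h
  · rw [h.neg_one_zpow, one_pow]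
  · rw [h.neg_one_zpow, neg_one_sq]

/-- By parity each equation is one of the original four times a sign. That sign squares away in
`ϑ_{αβ}²`, which the explicit sign in the equation compensates; for both characteristics odd the
last term vanishes with `ϑ₁ = 0`. -/
lemma IsSolution.isCharSolution {P : Params} {U : Set ℂ} {X : ℂ → Values} (h : IsSolution P U X) :
    IsCharSolution P U X := by
  refine ⟨h.ne_zero, fun α β z hz => ?_, h.eq5⟩
  have h1 := h.ne_zero z hz
  rcases Int.even_or_odd α with ha | ha <;> rcases Int.even_or_odd β with hb | hb
  · have ha' : ¬ Odd α := Int.not_odd_iff_even.2 ha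
    have hb' : ¬ Odd β := Int.not_odd_iff_even.2 hb
    have ha1 : Odd (α - 1) := ha.sub_odd odd_one
    have hb1 : Odd (β - 1) := hb.sub_odd odd_one
    have hs : ((-1 : ℂ) ^ (α * (β / 2))) = 1 := (ha.mul_right _).neg_one_zpow
    simp only [Values.char, Params.char, charFamily, mul_comm (β / 2) α, hs, ha', hb', ha1, hb1]
    simpa using h.eq3 z hz
  · have ha' : ¬ Odd α := Int.not_odd_iff_even.2 ha
    have ha1 : Odd (α - 1) := ha.sub_odd odd_one
    have hb1 : ¬ Odd (β - 1) := Int.not_odd_iff_even.2 (hb.sub_odd odd_one)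
    have hs : ((-1 : ℂ) ^ (α * (β / 2))) = 1 := (ha.mul_right _).neg_one_zpow
    simp only [Values.char, Params.char, charFamily, mul_comm (β / 2) α, hs, ha', hb, ha1, hb1]
    simpa using h.eq4 z hz
  · have hb' : ¬ Odd β := Int.not_odd_iff_even.2 hb
    have ha1 : ¬ Odd (α - 1) := Int.not_odd_iff_even.2 (ha.sub_odd odd_one)
    have hb1 : Odd (β - 1) := hb.sub_odd odd_one
    have hs := neg_one_zpow_sq (α * (β / 2))
    simp only [Values.char, Params.char, charFamily, mul_comm (β / 2) α, ha, hb', ha1, hb1]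
    simp only [if_true, if_false, mul_pow, hs]
    refine ((h.eq2 z hz).const_mul ((-1 : ℂ) ^ (α * (β / 2)))).congr_deriv ?_
    simp
    ring
  · have ha1 : ¬ Odd (α - 1) := Int.not_odd_iff_even.2 (ha.sub_odd odd_one)
    have hb1 : ¬ Odd (β - 1) := Int.not_odd_iff_even.2 (hb.sub_odd odd_one)
    simp only [Values.char, Params.char, charFamily, mul_comm (β / 2) α, ha, hb, ha1, hb1]
    simp only [if_true, if_false]
    refine ((h.eq1 z hz).neg.const_mul ((-1 : ℂ) ^ (α * (β / 2)))).congr_deriv ?_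
    simp
    field_simp

lemma IsCharSolution.isSolution {P : Params} {U : Set ℂ} {X : ℂ → Values}
    (h : IsCharSolution P U X) : IsSolution P U X := by
  refine ⟨h.ne_zero, fun z hz => ?_, fun z hz => ?_, fun z hz => ?_, fun z hz => ?_, h.eqD⟩
  · have h1 := h.ne_zero z hz
    have := (h.eqChar 1 1 z hz).fun_neg
    simpa [Values.char, Params.char, charFamily, h1] using this
  · simpa [Values.char, Params.char, charFamily] using h.eqChar 1 0 z hz
  · simpa [Values.char, Params.char, charFamily] using h.eqChar 0 0 z hz
  · simpa [Values.char, Params.char, charFamily] using h.eqChar 0 1 z hz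

/-! ### The explicit family -/

/-- The values with their signs changed. -/
def Values.signed (s1 s2 s3 s4 : ℤˣ) (V : Values) : Values where
  t1 := ((s1 : ℤ) : ℂ) * V.t1
  t2 := ((s2 : ℤ) : ℂ) * V.t2
  t3 := ((s3 : ℤ) : ℂ) * V.t3
  t4 := ((s4 : ℤ) : ℂ) * V.t4
  d1 := ((s1 : ℤ) : ℂ) * V.d1

lemma unit_cast_sq (s : ℤˣ) : ((s : ℤ) : ℂ) ^ 2 = 1 := by
  rcases Int.units_eq_one_or s with rfl | rfl <;> simp

lemma Values.signed_signed (s1 s2 s3 s4 : ℤˣ) (V : Values) :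
    (V.signed s1 s2 s3 s4).signed s1 s2 s3 s4 = V := by
  have h : ∀ (s : ℤˣ) (x : ℂ), ((s : ℤ) : ℂ) * (((s : ℤ) : ℂ) * x) = x := fun s x => by
    linear_combination x * unit_cast_sq s
  ext <;> exact h _ _

lemma extension_eq_signed (P : Params) (s1 s2 s3 s4 : ℤˣ) (A B C κ τ z : ℂ) :
    extension P s1 s2 s3 s4 A B C κ τ z
      = (extension P 1 1 1 1 A B C κ τ z).signed s1 s2 s3 s4 := by
  ext <;> simp [extension, Values.signed]

lemma Nondegenerate.signed {P : Params} {V : Values} (h : Nondegenerate P V) (s1 s2 s3 s4 : ℤˣ) :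
    Nondegenerate P (V.signed s1 s2 s3 s4) := by
  refine ⟨?_, ?_, ?_⟩ <;> simp only [Values.signed, mul_pow, unit_cast_sq, one_mul]
  exacts [h.h24, h.h23, h.h34]

/-- The terms `θ_νθ_μ/θ₁` acquire the sign of `θ_k` exactly because the product of the four signs is
`1`. -/
lemma IsSolution.signed {P : Params} {U : Set ℂ} {X : ℂ → Values} (h : IsSolution P U X)
    {s1 s2 s3 s4 : ℤˣ} (hs : s1 * s2 * s3 * s4 = 1) :
    IsSolution P U fun z => (X z).signed s1 s2 s3 s4 := by
  have hc : ((s1 : ℤ) : ℂ) * ((s2 : ℤ) : ℂ) * ((s3 : ℤ) : ℂ) * ((s4 : ℤ) : ℂ) = 1 := by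
    simpa using congrArg (fun s : ℤˣ => ((s : ℤ) : ℂ)) hs
  have q1 := unit_cast_sq s1
  have q2 := unit_cast_sq s2
  have q3 := unit_cast_sq s3
  have q4 := unit_cast_sq s4
  have n1 : ((s1 : ℤ) : ℂ) ≠ 0 := fun h => by simp [h] at q1
  simp only [Values.signed]
  generalize ((s1 : ℤ) : ℂ) = σ1 at *
  generalize ((s2 : ℤ) : ℂ) = σ2 at *
  generalize ((s3 : ℤ) : ℂ) = σ3 at *
  generalize ((s4 : ℤ) : ℂ) = σ4 at *
  have e2 : σ3 * σ4 / σ1 = σ2 := by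
    rw [div_eq_iff n1]; linear_combination σ1 * σ2 * hc - σ3 * σ4 * (σ2 ^ 2 * q1 + q2)
  have e3 : σ2 * σ4 / σ1 = σ3 := by
    rw [div_eq_iff n1]; linear_combination σ1 * σ3 * hc - σ2 * σ4 * (σ3 ^ 2 * q1 + q3)
  have e4 : σ2 * σ3 / σ1 = σ4 := by
    rw [div_eq_iff n1]; linear_combination σ1 * σ4 * hc - σ2 * σ3 * (σ4 ^ 2 * q1 + q4)
  refine ⟨fun z hz => mul_ne_zero n1 (h.ne_zero z hz), fun z hz => (h.eq1 z hz).const_mul σ1,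
    fun z hz => ((h.eq2 z hz).const_mul σ2).congr_deriv ?_,
    fun z hz => ((h.eq3 z hz).const_mul σ3).congr_deriv ?_,
    fun z hz => ((h.eq4 z hz).const_mul σ4).congr_deriv ?_,
    fun z hz => ((h.eq5 z hz).const_mul σ1).congr_deriv ?_⟩ <;>
    have hz1 := h.ne_zero z hz
  · rw [mul_div_mul_left _ _ n1, show σ3 * (X z).t3 * (σ4 * (X z).t4) / (σ1 * (X z).t1)
      = (σ3 * σ4 / σ1) * ((X z).t3 * (X z).t4 / (X z).t1) by field_simp, e2]
    ring
  · rw [mul_div_mul_left _ _ n1, show σ2 * (X z).t2 * (σ4 * (X z).t4) / (σ1 * (X z).t1)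
      = (σ2 * σ4 / σ1) * ((X z).t2 * (X z).t4 / (X z).t1) by field_simp, e3]
    ring
  · rw [mul_div_mul_left _ _ n1, show σ2 * (X z).t2 * (σ3 * (X z).t3) / (σ1 * (X z).t1)
      = (σ2 * σ3 / σ1) * ((X z).t2 * (X z).t3 / (X z).t1) by field_simp, e4]
    ring
  · rw [mul_pow, mul_pow, q1, q2]
    field_simp
    linear_combination ((X z).d1 ^ 2 - Real.pi ^ 2 * P.v3 ^ 2 * P.v4 ^ 2 * (X z).t2 ^ 2) * q1

section Extension

lemma hasDerivAt_exp_sq (M A z : ℂ) : HasDerivAt (fun w => cexp (2 * M * (w + A) ^ 2))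
    (4 * M * (z + A) * cexp (2 * M * (z + A) ^ 2)) z := by
  have h : HasDerivAt (fun w : ℂ => 2 * M * (w + A) ^ 2) (2 * M * (2 * (z + A))) z := by
    simpa using (((hasDerivAt_id z).add_const A).pow 2).const_mul (2 * M)
  exact h.cexp.congr_deriv (by ring)

lemma hasDerivAt_comp_affine {f : ℂ → ℂ} {f' κ B z : ℂ} (h : HasDerivAt f f' (κ * z + B)) :
    HasDerivAt (fun w => f (κ * w + B)) (κ * f') z := by
  have h1 : HasDerivAt (fun w : ℂ => κ * w + B) κ z := by
    simpa using ((hasDerivAt_id z).const_mul κ).add_const B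
  exact (h.comp z h1).congr_deriv (mul_comm _ _)

lemma hasDerivAt_gauge {f : ℂ → ℂ} {f' M κ A B N C z : ℂ} (h : HasDerivAt f f' (κ * z + B)) :
    HasDerivAt (fun w => N * (C * f (κ * w + B) * cexp (2 * M * (w + A) ^ 2)))
      (N * (C * (κ * f' + 4 * M * (z + A) * f (κ * z + B)) * cexp (2 * M * (z + A) ^ 2))) z :=
  ((((hasDerivAt_comp_affine h).const_mul C).mul (hasDerivAt_exp_sq M A z)).const_mul N).congr_deriv
    (by ring)

lemma hasDerivAt_gauge_deriv {τ : ℂ} (hτ : 0 < τ.im) (M κ A B N C z : ℂ) :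
    HasDerivAt (fun w => N * (C * (κ * dtheta1 (κ * w + B) τ
        + 4 * M * (w + A) * theta1 (κ * w + B) τ) * cexp (2 * M * (w + A) ^ 2)))
      (N * C * (κ ^ 2 * deriv (fun w => dtheta1 w τ) (κ * z + B) + 4 * M * theta1 (κ * z + B) τ
        + 2 * (4 * M * (z + A)) * κ * dtheta1 (κ * z + B) τ
        + (4 * M * (z + A)) ^ 2 * theta1 (κ * z + B) τ) * cexp (2 * M * (z + A) ^ 2)) z := by
  have h1 := hasDerivAt_comp_affine ((differentiable_dtheta1 hτ) (κ * z + B)).hasDerivAt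
  have h2 := hasDerivAt_comp_affine (hasDerivAt_theta1 hτ (κ * z + B))
  have h3 : HasDerivAt (fun w : ℂ => 4 * M * (w + A)) (4 * M) z := by
    simpa using ((hasDerivAt_id z).add_const A).const_mul (4 * M)
  exact (((((h1.const_mul κ).add (h3.mul h2)).const_mul C).mul
    (hasDerivAt_exp_sq M A z)).const_mul N).congr_deriv (by simp only [Pi.add_apply, Pi.mul_apply]; ring)

variable {P : Params} (A B C κ : ℂ) {τ : ℂ}

lemma two_mul_eta_pow_three (hτ : 0 < τ.im) :
    2 * ModularForm.eta τ ^ 3 = theta2 0 τ * theta3 0 τ * theta4 0 τ :=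
  (thetaProd_eq_eta hτ).symm

/-- With `2η³` rewritten as `ϑ₂ϑ₃ϑ₄(τ)` the prefactors match, the Gaussian cancels, and each
equation is `κ²` times a canonical relation at `κz + B`. -/
lemma isSolution_extension_one (h2 : P.v2 ≠ 0) (h3 : P.v3 ≠ 0) (h4 : P.v4 ≠ 0) (hC : C ≠ 0)
    (hτ : 0 < τ.im) :
    IsSolution P {z : ℂ | theta1 (κ * z + B) τ ≠ 0} (extension P 1 1 1 1 A B C κ τ) := by
  have n2 := theta2_ne_zero hτ
  have n3 := theta3_ne_zero hτ
  have n4 := theta4_ne_zero hτ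
  refine ⟨fun z hz => ?_, fun z hz => ?_, fun z hz => ?_, fun z hz => ?_, fun z hz => ?_,
    fun z hz => ?_⟩ <;> rw [Set.mem_ofPred_eq] at hz <;>
    simp only [extension, Units.val_one, Int.cast_one, one_mul, two_mul_eta_pow_three hτ] <;>
    have hE := Complex.exp_ne_zero (2 * coeffM P κ τ * (z + A) ^ 2)
  · simp [h2, h3, h4, n2, n3, n4, hC, hz]
  · exact hasDerivAt_gauge (f := fun w => theta1 w τ) (M := coeffM P κ τ) (hasDerivAt_theta1 hτ _)
  · refine (hasDerivAt_gauge (f := fun w => theta2 w τ) (M := coeffM P κ τ)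
      (hasDerivAt_theta2 hτ _)).congr_deriv ?_
    have W := wronskian21 hτ (κ * z + B)
    generalize cexp (2 * coeffM P κ τ * (z + A) ^ 2) = E at *
    generalize 4 * coeffM P κ τ * (z + A) = m at *
    field_simp
    linear_combination κ ^ 2 * W
  · refine (hasDerivAt_gauge (f := fun w => theta3 w τ) (M := coeffM P κ τ)
      (hasDerivAt_theta3 hτ _)).congr_deriv ?_
    have W := wronskian31 hτ (κ * z + B)
    generalize cexp (2 * coeffM P κ τ * (z + A) ^ 2) = E at *
    generalize 4 * coeffM P κ τ * (z + A) = m at *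
    field_simp
    linear_combination κ ^ 2 * W
  · refine (hasDerivAt_gauge (f := fun w => theta4 w τ) (M := coeffM P κ τ)
      (hasDerivAt_theta4 hτ _)).congr_deriv ?_
    have W := wronskian41 hτ (κ * z + B)
    generalize cexp (2 * coeffM P κ τ * (z + A) ^ 2) = E at *
    generalize 4 * coeffM P κ τ * (z + A) = m at *
    field_simp
    linear_combination κ ^ 2 * W
  · refine (hasDerivAt_gauge_deriv hτ _ _ _ _ _ _ _).congr_deriv ?_
    have W := second_order hτ (κ * z + B)
    have hM : P.lam = κ ^ 2 * (etaW τ + Real.pi ^ 2 / 12 * (theta3 0 τ ^ 4 + theta4 0 τ ^ 4))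
      - coeffM P κ τ := by rw [coeffM]; ring
    rw [hM]
    generalize etaW τ + Real.pi ^ 2 / 12 * (theta3 0 τ ^ 4 + theta4 0 τ ^ 4) = L at *
    generalize cexp (2 * coeffM P κ τ * (z + A) ^ 2) = E at *
    generalize 4 * coeffM P κ τ * (z + A) = m at *
    generalize coeffM P κ τ = M at *
    field_simp
    linear_combination κ ^ 2 * W

lemma isSolution_extension (h2 : P.v2 ≠ 0) (h3 : P.v3 ≠ 0) (h4 : P.v4 ≠ 0) (hC : C ≠ 0)
    (hτ : 0 < τ.im) {s1 s2 s3 s4 : ℤˣ} (hs : s1 * s2 * s3 * s4 = 1) :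
    IsSolution P {z : ℂ | theta1 (κ * z + B) τ ≠ 0} (extension P s1 s2 s3 s4 A B C κ τ) := by
  rw [funext (extension_eq_signed P s1 s2 s3 s4 A B C κ τ)]
  exact (isSolution_extension_one A B C κ h2 h3 h4 hC hτ).signed hs

lemma nondegenerate_extension (h2 : P.v2 ≠ 0) (h3 : P.v3 ≠ 0) (h4 : P.v4 ≠ 0) (hC : C ≠ 0)
    (hκ : κ ≠ 0) (hτ : 0 < τ.im) (s1 s2 s3 s4 : ℤˣ) {z : ℂ} (hz : theta1 (κ * z + B) τ ≠ 0) :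
    Nondegenerate P (extension P s1 s2 s3 s4 A B C κ τ z) := by
  rw [extension_eq_signed]
  refine Nondegenerate.signed ?_ s1 s2 s3 s4
  have n2 := theta2_ne_zero hτ
  have n3 := theta3_ne_zero hτ
  have n4 := theta4_ne_zero hτ
  have hE := Complex.exp_ne_zero (2 * coeffM P κ τ * (z + A) ^ 2)
  -- By the quadratic relations each of the three quantities is the square of a non-zero multiple of
  -- `θ₁(κz + B)`.
  have key : ∀ {a b v w x y t n : ℂ}, a ≠ 0 → b ≠ 0 → v ≠ 0 → w ≠ 0 → n ≠ 0 →
      a ^ 2 * y ^ 2 - b ^ 2 * x ^ 2 = n ^ 2 * t ^ 2 → t ≠ 0 →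
      v ^ 2 * (κ * w / b * (C * y * cexp (2 * coeffM P κ τ * (z + A) ^ 2))) ^ 2
        - w ^ 2 * (κ * v / a * (C * x * cexp (2 * coeffM P κ τ * (z + A) ^ 2))) ^ 2 ≠ 0 := by
    intro a b v w x y t n ha hb hv hw hn h ht
    have : v ^ 2 * (κ * w / b * (C * y * cexp (2 * coeffM P κ τ * (z + A) ^ 2))) ^ 2
        - w ^ 2 * (κ * v / a * (C * x * cexp (2 * coeffM P κ τ * (z + A) ^ 2))) ^ 2
        = (κ * v * w * C * cexp (2 * coeffM P κ τ * (z + A) ^ 2) * n * t / (a * b)) ^ 2 := by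
      generalize cexp (2 * coeffM P κ τ * (z + A) ^ 2) = E at *
      field_simp
      linear_combination h
    rw [this]
    positivity
  refine ⟨?_, ?_, ?_⟩ <;> simp only [extension, Units.val_one, Int.cast_one, one_mul]
  · exact key n2 n4 h2 h4 n3 (theta_sq_rel24 hτ _) hz
  · exact key n2 n3 h2 h3 n4 (theta_sq_rel23 hτ _) hz
  · exact key n3 n4 h3 h4 n2 (theta_sq_rel34 hτ _) hz

lemma differentiable_extension_vec (hτ : 0 < τ.im) (s1 s2 s3 s4 : ℤˣ) :
    Differentiable ℂ fun w => (extension P s1 s2 s3 s4 A B C κ τ w).vec := fun z =>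
  (((hasDerivAt_gauge (hasDerivAt_theta1 hτ _)).const_mul _).prodMk
    (((hasDerivAt_gauge (hasDerivAt_theta2 hτ _)).const_mul _).prodMk
    (((hasDerivAt_gauge (hasDerivAt_theta3 hτ _)).const_mul _).prodMk
    (((hasDerivAt_gauge (hasDerivAt_theta4 hτ _)).const_mul _).prodMk
    ((hasDerivAt_gauge_deriv hτ _ _ _ _ _ _ z).const_mul _))))).differentiableAt

end Extension

/-! ### Initial values -/

/-- Prescribed ratios of the quadratic integrals determine `τ` and `κ`, up to a choice which allows
to avoid one value of the last expression. -/
lemma exists_modulus {a2 a3 a4 v : ℂ} (L : ℂ) (h24 : a4 ≠ a2) (h23 : a3 ≠ a2) (h34 : a4 ≠ a3)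
    (hv : v ≠ 0) :
    ∃ κ τ : ℂ, κ ≠ 0 ∧ 0 < τ.im ∧ κ ^ 2 * theta3 0 τ ^ 4 = v ^ 2 * (a4 - a2)
      ∧ κ ^ 2 * theta4 0 τ ^ 4 = v ^ 2 * (a3 - a2)
      ∧ κ ^ 2 * (etaW τ + Real.pi ^ 2 / 12 * (theta3 0 τ ^ 4 + theta4 0 τ ^ 4)) - L ≠ 0 := by
  have d24 := sub_ne_zero.2 h24
  -- The required equations and `ϑ₃⁴ = ϑ₂⁴ + ϑ₄⁴` force `κ²ϑ₂⁴ = v²(a4 - a3)`, hence this value of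
  -- `λ`. Nondegeneracy makes it different from `0` and `1`.
  obtain ⟨τ, hτ, hl⟩ := modLambda_surjective (w := (a4 - a3) / (a4 - a2))
    (div_ne_zero (sub_ne_zero.2 h34) d24)
    (fun h => h23 (by rw [div_eq_one_iff_eq d24] at h; linear_combination -h))
  have n3 := theta3_ne_zero hτ
  obtain ⟨κ, hκ⟩ := IsAlgClosed.exists_pow_nat_eq (v ^ 2 * (a4 - a2) / theta3 0 τ ^ 4) two_pos
  have e3 : κ ^ 2 * theta3 0 τ ^ 4 = v ^ 2 * (a4 - a2) := by
    rw [hκ]; field_simp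
  have hκ0 : κ ≠ 0 := by
    rintro rfl
    rw [zero_pow two_ne_zero, zero_mul] at e3
    exact mul_ne_zero (pow_ne_zero 2 hv) d24 e3.symm
  have e4 : κ ^ 2 * theta4 0 τ ^ 4 = v ^ 2 * (a3 - a2) := by
    have h1 := one_sub_modLambda hτ
    rw [hl, eq_div_iff (pow_ne_zero 4 n3)] at h1
    rw [← h1]
    have : (1 - (a4 - a3) / (a4 - a2)) * (a4 - a2) = a3 - a2 := by field_simp; ring
    linear_combination (1 - (a4 - a3) / (a4 - a2)) * e3 + v ^ 2 * this
  by_cases hM : κ ^ 2 * (etaW τ + Real.pi ^ 2 / 12 * (theta3 0 τ ^ 4 + theta4 0 τ ^ 4)) - L = 0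
  · obtain ⟨τ', c, e, hτ', hc, he, -, c3, c4, cη⟩ := exists_congruent_modulus hτ
    refine ⟨κ / c, τ', div_ne_zero hκ0 hc, hτ', ?_, ?_, ?_⟩
    · rw [c3, ← e3]; field_simp
    · rw [c4, ← e4]; field_simp
    · rw [c3, c4, cη]
      have : (κ / c) ^ 2 * (c ^ 2 * etaW τ + e
          + Real.pi ^ 2 / 12 * (c ^ 2 * theta3 0 τ ^ 4 + c ^ 2 * theta4 0 τ ^ 4)) - L
          = (κ / c) ^ 2 * e := by
        rw [← sub_eq_zero.1 hM]; field_simp; ring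
      rw [this]
      positivity
  · exact ⟨κ, τ, hκ0, hτ, e3, e4, hM⟩

/-- Half-period shifts of the argument and `κ ↦ -κ` produce all combinations of signs. -/
lemma exists_shift_signs {κ τ u : ℂ} (hu : theta1 u τ ≠ 0)
    {p2 p3 p4 q2 q3 q4 : ℂ} (h2 : (κ * p2 * theta2 u τ) ^ 2 = (q2 * theta1 u τ) ^ 2)
    (h3 : (κ * p3 * theta3 u τ) ^ 2 = (q3 * theta1 u τ) ^ 2)
    (h4 : (κ * p4 * theta4 u τ) ^ 2 = (q4 * theta1 u τ) ^ 2) :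
    ∃ κ' u' : ℂ, κ' ^ 2 = κ ^ 2 ∧ theta1 u' τ ≠ 0 ∧ κ' * p2 * theta2 u' τ = q2 * theta1 u' τ
      ∧ κ' * p3 * theta3 u' τ = q3 * theta1 u' τ ∧ κ' * p4 * theta4 u' τ = q4 * theta1 u' τ := by
  obtain ⟨κ, hκ, h2⟩ : ∃ κ' : ℂ, κ' ^ 2 = κ ^ 2 ∧ κ' * p2 * theta2 u τ = q2 * theta1 u τ := by
    rcases sq_eq_sq_iff_eq_or_eq_neg.1 h2 with h | h
    · exact ⟨κ, rfl, h⟩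
    · exact ⟨-κ, neg_sq κ, by linear_combination -h⟩
  rw [mul_pow, mul_pow, ← hκ, ← mul_pow, ← mul_pow] at h3 h4
  rw [← hκ]
  clear hκ
  obtain ⟨u, hu, h2, h3, h4⟩ : ∃ u' : ℂ, theta1 u' τ ≠ 0 ∧ κ * p2 * theta2 u' τ = q2 * theta1 u' τ
      ∧ κ * p3 * theta3 u' τ = q3 * theta1 u' τ
      ∧ (κ * p4 * theta4 u' τ) ^ 2 = (q4 * theta1 u' τ) ^ 2 := by
    rcases sq_eq_sq_iff_eq_or_eq_neg.1 h3 with h | h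
    · exact ⟨u, hu, h2, h, h4⟩
    -- The shift by `1` preserves `θ₂/θ₁` and reverses `θ₃/θ₁` and `θ₄/θ₁`.
    · refine ⟨u + 1, ?_, ?_, ?_, ?_⟩ <;>
        simp only [theta1_add_one, theta2_add_one, theta3_add_one, theta4_add_one]
      · exact neg_ne_zero.2 hu
      · linear_combination -h2
      · linear_combination h
      · linear_combination h4
  rcases sq_eq_sq_iff_eq_or_eq_neg.1 h4 with h | h
  · exact ⟨κ, u, rfl, hu, h2, h3, h⟩
  -- The shift by `τ` reverses `θ₂/θ₁` and `θ₃/θ₁`; together with `κ ↦ -κ` only the relation for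
  -- `θ₄` changes sign.
  · refine ⟨-κ, u + τ, neg_sq κ, ?_, ?_, ?_, ?_⟩ <;>
      simp only [theta1_add_tau, theta2_add_tau, theta3_add_tau, theta4_add_tau]
    · exact neg_ne_zero.2 (mul_ne_zero (Complex.exp_ne_zero _) hu)
    · linear_combination -cexp (-Real.pi * I * (τ + 2 * u)) * h2
    · linear_combination -cexp (-Real.pi * I * (τ + 2 * u)) * h3
    · linear_combination cexp (-Real.pi * I * (τ + 2 * u)) * h

lemma exists_extension_one_eq {P : Params} (h2 : P.v2 ≠ 0) (h3 : P.v3 ≠ 0) (h4 : P.v4 ≠ 0)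
    (z₀ : ℂ) {V : Values} (ht : V.t1 ≠ 0) (hV : Nondegenerate P V) :
    ∃ A B C κ τ : ℂ, C ≠ 0 ∧ κ ≠ 0 ∧ 0 < τ.im ∧ extension P 1 1 1 1 A B C κ τ z₀ = V := by
  obtain ⟨κ₀, τ, hκ₀, hτ, e3, e4, hM⟩ := exists_modulus (a2 := V.t2 ^ 2 / (P.v2 ^ 2 * V.t1 ^ 2))
    (a3 := V.t3 ^ 2 / (P.v3 ^ 2 * V.t1 ^ 2)) (a4 := V.t4 ^ 2 / (P.v4 ^ 2 * V.t1 ^ 2))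
    (v := P.v2 * P.v3 * P.v4) P.lam
    (fun h => hV.h24 (by field_simp at h; linear_combination h))
    (fun h => hV.h23 (by field_simp at h; linear_combination h))
    (fun h => hV.h34 (by field_simp at h; linear_combination h))
    (by positivity)
  have n2 := theta2_ne_zero hτ
  have n3 := theta3_ne_zero hτ
  have n4 := theta4_ne_zero hτ
  -- Only the ratio `θ₂²/θ₁²` has to be matched by the choice of `u₀`; those of `θ₃²` and `θ₄²`
  -- follow from the quadratic relations and the choice of `κ₀`, `τ`.
  obtain ⟨u₀, hu₀, e2⟩ := exists_theta2_sq_eq hτ (x := κ₀ ^ 2 * theta3 0 τ ^ 2 * theta4 0 τ ^ 2)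
    (by positivity) ((P.v2 * P.v3 * P.v4) ^ 2 * (V.t2 ^ 2 / (P.v2 ^ 2 * V.t1 ^ 2)))
  have r24 := theta_sq_rel24 hτ u₀
  have r23 := theta_sq_rel23 hτ u₀
  have f3 : κ₀ ^ 2 * theta2 0 τ ^ 2 * theta4 0 τ ^ 2 * theta3 u₀ τ ^ 2
      = (P.v2 * P.v3 * P.v4) ^ 2 * (V.t3 ^ 2 / (P.v3 ^ 2 * V.t1 ^ 2)) * theta1 u₀ τ ^ 2 := by
    linear_combination κ₀ ^ 2 * theta4 0 τ ^ 2 * r23 + e2 + theta1 u₀ τ ^ 2 * e4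
  have f4 : κ₀ ^ 2 * theta2 0 τ ^ 2 * theta3 0 τ ^ 2 * theta4 u₀ τ ^ 2
      = (P.v2 * P.v3 * P.v4) ^ 2 * (V.t4 ^ 2 / (P.v4 ^ 2 * V.t1 ^ 2)) * theta1 u₀ τ ^ 2 := by
    linear_combination κ₀ ^ 2 * theta3 0 τ ^ 2 * r24 + e2 + theta1 u₀ τ ^ 2 * e3
  obtain ⟨κ, u, hκ, hu, g2, g3, g4⟩ := exists_shift_signs hu₀ (κ := κ₀)
    (p2 := theta3 0 τ * theta4 0 τ * P.v2 * V.t1) (q2 := P.v2 * P.v3 * P.v4 * V.t2)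
    (p3 := theta2 0 τ * theta4 0 τ * P.v3 * V.t1) (q3 := P.v2 * P.v3 * P.v4 * V.t3)
    (p4 := theta2 0 τ * theta3 0 τ * P.v4 * V.t1) (q4 := P.v2 * P.v3 * P.v4 * V.t4)
    (by field_simp at e2; linear_combination P.v2 ^ 2 * e2)
    (by field_simp at f3; linear_combination P.v3 ^ 2 * f3)
    (by field_simp at f4; linear_combination P.v4 ^ 2 * f4)
  have hκ0 : κ ≠ 0 := fun h => by
    rw [h, zero_pow two_ne_zero] at hκ
    exact pow_ne_zero 2 hκ₀ hκ.symm
  have hM' : coeffM P κ τ ≠ 0 := by rwa [coeffM, hκ]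
  set M := coeffM P κ τ with hMdef
  -- `A` solves `κ θ₁'(u)/θ₁(u) + 4M(z₀ + A) = V.d1 / V.t1`; this is where `M ≠ 0` is needed.
  set A := (V.d1 / V.t1 - κ * dtheta1 u τ / theta1 u τ) / (4 * M) - z₀ with hA
  have hd : 4 * M * (z₀ + A) = V.d1 / V.t1 - κ * dtheta1 u τ / theta1 u τ := by
    rw [hA]; field_simp; ring
  have hE := Complex.exp_ne_zero (2 * M * (z₀ + A) ^ 2)
  refine ⟨A, u - κ * z₀, V.t1 * (theta2 0 τ * theta3 0 τ * theta4 0 τ)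
    / (P.v2 * P.v3 * P.v4 * theta1 u τ * cexp (2 * M * (z₀ + A) ^ 2)), κ, τ, by positivity, hκ0,
    hτ, ?_⟩
  simp only [extension, add_sub_cancel, Units.val_one, Int.cast_one, one_mul,
    two_mul_eta_pow_three hτ, ← hMdef, hd]
  generalize cexp (2 * M * (z₀ + A) ^ 2) = E at *
  ext <;> simp only
  · field_simp
  · field_simp at g2 ⊢
    linear_combination g2
  · field_simp at g3 ⊢
    linear_combination g3
  · field_simp at g4 ⊢
    linear_combination g4
  · field_simp
    ring

lemma exists_extension_eq {P : Params} (h2 : P.v2 ≠ 0) (h3 : P.v3 ≠ 0) (h4 : P.v4 ≠ 0)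
    (s1 s2 s3 s4 : ℤˣ) (z₀ : ℂ) {V : Values} (ht : V.t1 ≠ 0) (hV : Nondegenerate P V) :
    ∃ A B C κ τ : ℂ, C ≠ 0 ∧ κ ≠ 0 ∧ 0 < τ.im ∧ extension P s1 s2 s3 s4 A B C κ τ z₀ = V := by
  have hs : ((s1 : ℤ) : ℂ) ≠ 0 := by exact_mod_cast s1.ne_zero
  obtain ⟨A, B, C, κ, τ, hC, hκ, hτ, h⟩ := exists_extension_one_eq h2 h3 h4 z₀
    -- Changing signs is an involution, so the family with signs reaches `V` when the unsigned one
    -- reaches the signed `V`.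
    (V := V.signed s1 s2 s3 s4) (mul_ne_zero hs ht) (hV.signed s1 s2 s3 s4)
  exact ⟨A, B, C, κ, τ, hC, hκ, hτ, by rw [extension_eq_signed, h, Values.signed_signed]⟩

lemma exists_eqOn_extension {P : Params} (h2 : P.v2 ≠ 0) (h3 : P.v3 ≠ 0) (h4 : P.v4 ≠ 0)
    {s1 s2 s3 s4 : ℤˣ} (hs : s1 * s2 * s3 * s4 = 1) {U : Set ℂ} {X : ℂ → Values} (hU : IsOpen U)
    (hc : IsPreconnected U) (hX : IsSolution P U X) {z₀ : ℂ} (hz : z₀ ∈ U)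
    (hV : Nondegenerate P (X z₀)) :
    ∃ A B C κ τ : ℂ, C ≠ 0 ∧ κ ≠ 0 ∧ 0 < τ.im ∧
      ∀ z ∈ U, X z = extension P s1 s2 s3 s4 A B C κ τ z := by
  obtain ⟨A, B, C, κ, τ, hC, hκ, hτ, h⟩ :=
    exists_extension_eq h2 h3 h4 s1 s2 s3 s4 z₀ (hX.ne_zero z₀ hz) hV
  have hop : IsOpen {z : ℂ | theta1 (κ * z + B) τ ≠ 0} :=
    isOpen_ne_fun ((differentiable_theta1 hτ).continuous.comp (by fun_prop)) continuous_const
  have hmem : theta1 (κ * z₀ + B) τ ≠ 0 := fun h0 => hX.ne_zero z₀ hz (by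
    rw [← h]; simp [extension, h0])
  exact ⟨A, B, C, κ, τ, hC, hκ, hτ, hX.eqOn_of_differentiable
    (isSolution_extension A B C κ h2 h3 h4 hC hτ hs) hU hc hz (hop.mem_nhds hmem)
    (differentiable_extension_vec A B C κ hτ s1 s2 s3 s4) h.symm⟩

end ThetaODE

end

theorem theorem9p1 (P : ThetaODE.Params) (h2 : P.v2 ≠ 0) (h3 : P.v3 ≠ 0) (h4 : P.v4 ≠ 0) :
    -- the two forms of the system have the same solutions
    (∀ (U : Set ℂ) (X : ℂ → ThetaODE.Values),
      ThetaODE.IsSolution P U X ↔ ThetaODE.IsCharSolution P U X) ∧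
    -- for every choice of signs with an even number of minuses
    ∀ s1 s2 s3 s4 : ℤˣ, s1 * s2 * s3 * s4 = 1 →
      -- the formulas give solutions for all values of the constants
      (∀ A B C κ τ : ℂ, C ≠ 0 → 0 < τ.im →
        ThetaODE.IsSolution P {z : ℂ | ThetaODE.theta1 (κ * z + B) τ ≠ 0}
          (ThetaODE.extension P s1 s2 s3 s4 A B C κ τ)) ∧
      -- which are nondegenerate for `κ ≠ 0`
      (∀ A B C κ τ : ℂ, C ≠ 0 → κ ≠ 0 → 0 < τ.im →
        ∀ z : ℂ, ThetaODE.theta1 (κ * z + B) τ ≠ 0 →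
          ThetaODE.Nondegenerate P (ThetaODE.extension P s1 s2 s3 s4 A B C κ τ z)) ∧
      -- the constants realize all nondegenerate initial values
      (∀ (z₀ : ℂ) (V : ThetaODE.Values), V.t1 ≠ 0 → ThetaODE.Nondegenerate P V →
        ∃ A B C κ τ : ℂ, C ≠ 0 ∧ κ ≠ 0 ∧ 0 < τ.im ∧
          ThetaODE.extension P s1 s2 s3 s4 A B C κ τ z₀ = V) ∧
      -- and every nondegenerate solution is given by the formulas
      (∀ (U : Set ℂ) (X : ℂ → ThetaODE.Values), IsOpen U → IsPreconnected U →
        ThetaODE.IsSolution P U X → (∃ z₀ ∈ U, ThetaODE.Nondegenerate P (X z₀)) →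
        ∃ A B C κ τ : ℂ, C ≠ 0 ∧ κ ≠ 0 ∧ 0 < τ.im ∧
          ∀ z ∈ U, X z = ThetaODE.extension P s1 s2 s3 s4 A B C κ τ z) := by
  refine ⟨fun U X => ⟨fun h => h.isCharSolution, fun h => h.isSolution⟩,
    fun s1 s2 s3 s4 hs => ⟨?_, ?_, ?_, ?_⟩⟩
  · intro A B C κ τ hC hτ
    exact ThetaODE.isSolution_extension A B C κ h2 h3 h4 hC hτ hs
  · intro A B C κ τ hC hκ hτ z hz
    exact ThetaODE.nondegenerate_extension A B C κ h2 h3 h4 hC hκ hτ s1 s2 s3 s4 hz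
  · intro z₀ V ht hV
    exact ThetaODE.exists_extension_eq h2 h3 h4 s1 s2 s3 s4 z₀ ht hV
  · rintro U X hU hc hX ⟨z₀, hz, hV⟩
    exact ThetaODE.exists_eqOn_extension h2 h3 h4 hs hU hc hX hz hV
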